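/- Let $X$ be a one-dimensional complex manifold (for instance a compact Riemann surface of genus at least $2$) with canonical bundle $K$, and let $n\ge 1$. (a) Consider generalized $\mathsf{B}$-opers $(E,\{F_1\subset F_2=E\},D)$ of the following kind: $E$ is a holomorphic vector bundle of rank $2n$ on $X$ with a holomorphic symplectic form $\mathsf{B}$; $F_1\subset E$ is a holomorphic subbundle of rank $n$ with $F_1^{\perp}=F_1$; $D$ is a holomorphic connection on $E$ with $d(\mathsf{B}(s,t))=\mathsf{B}(Ds,t)+\mathsf{B}(s,Dt)$ for holomorphic local sections $s,t$; and the second fundamental form $s\mapsto Ds \bmod F_1$ induces an isomorphism $S_D:F_1\to (F_2/F_1)\otimes K$. Their morphisms are the isomorphisms of holomorphic vector bundles that match $\mathsf{B}$, $F_1$ and $D$. (b) Let $G=\mathrm{Sp}(2n,\mathbb{C})$ and let $(f,h,e)$ be a $\Theta$-principal triple for $\Theta=\{\alpha_n\}$, the long simple root of type $C_n$: $e$ lies in $\mathfrak{u}_\Theta\subset\mathfrak{sp}(2n,\mathbb{R})$, i.e. in the space of real symmetric $n\times n$ matrices placed in the upper right block, that block is positive definite or negative definite, $f=e^{T}$,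 $h=[e,f]$, $[h,e]=2e$, $[h,f]=-2f$. Let $\mathfrak{p}=\bigoplus_{k\ge 0}\mathfrak{g}_k$ and $\mathfrak{u}=\bigoplus_{k>0}\mathfrak{g}_k$, where $\mathfrak{g}_k$ is the $k$-eigenspace of $\mathrm{ad}_h$ on $\mathfrak{g}=\mathfrak{sp}(2n,\mathbb{C})$, and let $P_\Theta$ be the normalizer of $\mathfrak{u}$ in $G$. Consider $\Theta$-positive opers $(\mathcal{P}_G,\mathcal{P}_{P_\Theta},\omega)$: a holomorphic principal $G$-bundle on $X$, a holomorphic reduction of its structure group to $P_\Theta$, and a holomorphic principal connection $\omega$ whose second fundamental form (the restriction of $\omega$ to $\mathcal{P}_{P_\Theta}$ modulo $\mathfrak{p}$, evaluated on nonzero tangent vectors of $X$) takes values in the orbit $P_\Theta\cdot f\subset\mathfrak{g}/\mathfrak{p}$. Their morphisms are the isomorphisms of holomorphic principal $G$-bundles that match the reductions and the connections. Then the data (a) and (b) are equivalent: the associated bundle construction, which sends $(\mathcal{P}_G,\mathcal{P}_{P_\Theta},\omega)$ to $E=\mathcal{P}_G\times_G\mathbb{C}^{2n}$ with the form $\mathsf{B}$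 induced by the standard symplectic form, the subbundle $F_1=\mathcal{P}_{P_\Theta}\times_{P_\Theta}(\mathbb{C}^n\oplus 0)$ and the connection $D$ induced by $\omega$, is an equivalence from the category of $\Theta$-positive opers (b) to the category of generalized $\mathsf{B}$-opers (a). -/

import Mathlib

open Bundle Matrix CategoryTheory
open scoped Manifold ContDiff Topology RightActions

universe u v

namespace Opers

attribute [local instance] LieRing.ofAssociativeRing

/-! ## The group `Sp(2n, ℂ)`, its Lie algebra and the parabolic of an `𝔰𝔩₂`-triple -/

/-- Complex `2n × 2n` matrices. -/
abbrev Mat (n : ℕ) : Type := Matrix (Fin n ⊕ Fin n) (Fin n ⊕ Fin n) ℂ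

/-- `G = Sp(2n, ℂ)`, the group of the standard symplectic form `(v, w) ↦ vᵀ J w` of `ℂ²ⁿ`. -/
abbrev SpC (n : ℕ) : Type := ↥(symplecticGroup (Fin n) ℂ)

/-- The standard representation `ℂ²ⁿ` of `Sp(2n, ℂ)`. -/
abbrev Std (n : ℕ) : Type := Fin n ⊕ Fin n → ℂ

/-- The Lie algebra `𝔰𝔭(2n, ℂ)`, as a space of matrices. -/
abbrev spLie (n : ℕ) : LieSubalgebra ℂ (Mat n) := LieAlgebra.Symplectic.sp (Fin n) ℂ

/-- The eigenspace `𝔤_k = {x ∈ 𝔰𝔭(2n, ℂ) | [h, x] = k x}` of `ad h`. -/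
def gradedPiece {n : ℕ} (h : Mat n) (k : ℤ) : Submodule ℂ (Mat n) where
  carrier := {x | x ∈ spLie n ∧ ⁅h, x⁆ = (k : ℂ) • x}
  add_mem' := by
    rintro x y ⟨hx, hx'⟩ ⟨hy, hy'⟩
    exact ⟨add_mem hx hy, by rw [lie_add, hx', hy', smul_add]⟩
  zero_mem' := ⟨zero_mem _, by simp⟩
  smul_mem' := by
    rintro c x ⟨hx, hx'⟩
    exact ⟨(spLie n).smul_mem c hx, by rw [lie_smul, hx', smul_comm]⟩

/-- The parabolic subalgebra `𝔭 = ⨁_{k ≥ 0} 𝔤_k`. -/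
def parabolicLie {n : ℕ} (h : Mat n) : Submodule ℂ (Mat n) :=
  ⨆ (k : ℤ) (_ : 0 ≤ k), gradedPiece h k

/-- The nilpotent subalgebra `𝔲 = ⨁_{k > 0} 𝔤_k`. -/
def nilpotentLie {n : ℕ} (h : Mat n) : Submodule ℂ (Mat n) :=
  ⨆ (k : ℤ) (_ : 0 < k), gradedPiece h k

/-- The adjoint action of `Sp(2n, ℂ)` on matrices, `Ad(g) x = g x g⁻¹`. -/
def Ad {n : ℕ} (g : SpC n) (x : Mat n) : Mat n := (g : Mat n) * x * ((g⁻¹ : SpC n) : Mat n)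

theorem Ad_one {n : ℕ} (x : Mat n) : Ad (1 : SpC n) x = x := by
  simp [Ad]

theorem Ad_mul {n : ℕ} (g k : SpC n) (x : Mat n) : Ad (g * k) x = Ad g (Ad k x) := by
  simp only [Ad, _root_.mul_inv_rev, Submonoid.coe_mul, mul_assoc]

/-- The parabolic subgroup `P`: the normalizer of `𝔲` in `Sp(2n, ℂ)`. -/
def parabolic {n : ℕ} (h : Mat n) : Subgroup (SpC n) where
  carrier := {g | ∀ x, Ad g x ∈ nilpotentLie h ↔ x ∈ nilpotentLie h}
  mul_mem' := by
    intro a b ha hb x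
    rw [Ad_mul, ha, hb]
  one_mem' := by
    intro x
    rw [Ad_one]
  inv_mem' := by
    intro a ha x
    rw [← ha, ← Ad_mul, mul_inv_cancel, Ad_one]

/-! ## The `Θ`-principal triples of `𝔰𝔭(2n, ℝ)` -/

/-- Real `2n × 2n` matrices. -/
abbrev RMat (n : ℕ) : Type := Matrix (Fin n ⊕ Fin n) (Fin n ⊕ Fin n) ℝ

/-- The element `diag(t, -t)` of the standard (split) Cartan subalgebra of `𝔰𝔭(2n, ℝ)`. -/
def cartanElement {n : ℕ} (t : Fin n → ℝ) : RMat n :=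
  fromBlocks (diagonal t) 0 0 (-diagonal t)

/-- The restricted root space of the functional `diag(t, -t) ↦ ∑ i, μ i * t i`. -/
def rootSpace {n : ℕ} (μ : Fin n → ℝ) : Submodule ℝ (RMat n) where
  carrier := {x | x ∈ LieAlgebra.Symplectic.sp (Fin n) ℝ ∧
    ∀ t : Fin n → ℝ, ⁅cartanElement t, x⁆ = (μ ⬝ᵥ t) • x}
  add_mem' := by
    rintro x y ⟨hx, hx'⟩ ⟨hy, hy'⟩
    exact ⟨add_mem hx hy, fun t => by rw [lie_add, hx', hy', smul_add]⟩
  zero_mem' := ⟨zero_mem _, by simp⟩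
  smul_mem' := by
    rintro c x ⟨hx, hx'⟩
    exact ⟨(LieAlgebra.Symplectic.sp (Fin n) ℝ).smul_mem c hx,
      fun t => by rw [lie_smul, hx', smul_comm]⟩

/-- The simple roots of type `Cₙ`: `t_i - t_{i+1}` for `i < n` and the long root `2 t_n`
(the index of `Fin n` starts from `0`). -/
def simpleRoot {n : ℕ} (i : Fin n) : Fin n → ℝ :=
  if hi : i.val + 1 < n then Pi.single i 1 - Pi.single ⟨i.val + 1, hi⟩ 1 else Pi.single i 2

/-- Positive restricted roots: roots that are sums of simple roots. -/
def IsPositiveRoot {n : ℕ} (μ : Fin n → ℝ) : Prop :=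
  μ ≠ 0 ∧ rootSpace μ ≠ ⊥ ∧ ∃ c : Fin n → ℕ, μ = ∑ i, c i • simpleRoot i

/-- `𝔲_Θ`, the sum of the root spaces of the positive roots outside the span of `Δ ∖ Θ`. -/
def thetaNilradical {n : ℕ} (Θ : Set (Fin n)) : Submodule ℝ (RMat n) :=
  ⨆ (μ : Fin n → ℝ) (_ : IsPositiveRoot μ ∧ μ ∉ Submodule.span ℝ (simpleRoot '' Θᶜ)), rootSpace μ

/-- `Θ = {αₙ}`, the long simple root. -/
def longRoot (n : ℕ) : Set (Fin n) := {i | i.val + 1 = n}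

/-- `(f, h, e)` is a `Θ`-principal triple of `𝔰𝔭(2n, ℝ)` for `Θ = {αₙ}`.

Here `𝔲_Θ` is the space of symmetric matrices (placed in the upper right block), and the
`Θ`-positive structure of `Sp(2n, ℝ)` is the cone of positive semidefinite ones (or its opposite,
which is the only other choice); `e` is to lie in its interior, `f = -ρ(e)` for the Cartan
involution `ρ(x) = -xᵀ`, and `h = [e, f]`. As `Θ` has one element, there is only one triple in a
`Θ`-base, and it is the `Θ`-principal triple. -/
structure IsThetaPrincipalTriple {n : ℕ} (f h e : RMat n) : Prop where
  e_mem : e ∈ thetaNilradical (longRoot n)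
  e_cone : e.toBlocks₁₂.PosDef ∨ (-e.toBlocks₁₂).PosDef
  f_eq : f = eᵀ
  h_eq : h = ⁅e, f⁆
  lie_h_e : ⁅h, e⁆ = (2 : ℝ) • e
  lie_h_f : ⁅h, f⁆ = -((2 : ℝ) • f)

/-- A real matrix, seen as a complex one. -/
def complexify {n : ℕ} (x : RMat n) : Mat n := x.map Complex.ofReal

/-! ## Holomorphic functions, vector fields and sections -/

variable {X : Type u} [TopologicalSpace X] [ChartedSpace ℂ X]

/-- The function `φ` is holomorphic in a neighbourhood of `x`. -/
def HolAt (φ : X → ℂ) (x : X) : Prop := ContMDiffAt 𝓘(ℂ) 𝓘(ℂ) ω φ x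

/-- The vector field `V` is holomorphic in a neighbourhood of `x`. -/
def HolVectorFieldAt [IsManifold 𝓘(ℂ) ω X] (V : ∀ y : X, TangentSpace 𝓘(ℂ) y) (x : X) : Prop :=
  ContMDiffAt 𝓘(ℂ) 𝓘(ℂ).tangent ω (fun y => (⟨y, V y⟩ : TangentBundle 𝓘(ℂ) X)) x

/-- The `Sp(2n, ℂ)`-valued function `g` is holomorphic in a neighbourhood of `x`. -/
def HolGroupAt {n : ℕ} (g : X → SpC n) (x : X) : Prop :=
  ∀ i j, HolAt (fun y => (g y : Mat n) i j) x

/-- The derivative `dg(ξ)` of an `Sp(2n, ℂ)`-valued function, entry by entry. -/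
noncomputable def dGroup {n : ℕ} (g : X → SpC n) (x : X) (ξ : TangentSpace 𝓘(ℂ) x) : Mat n :=
  Matrix.of fun i j => mvfderiv 𝓘(ℂ) (fun y => (g y : Mat n) i j) x ξ

/-! ## Holomorphic principal `Sp(2n, ℂ)`-bundles -/

section Principal

variable (n : ℕ) (P : X → Type v) [TopologicalSpace (TotalSpace (SpC n) P)]
  [∀ x, TopologicalSpace (P x)] [FiberBundle (SpC n) P] [∀ x, MulAction (SpC n)ᵐᵒᵖ (P x)]

/-- A fibre bundle with fibre `G = Sp(2n, ℂ)` and a right action of `G` on its fibres is a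
holomorphic principal `G`-bundle if its trivializations are `G`-equivariant and its transition
functions are holomorphic. -/
class IsHolPrincipalBundle : Prop where
  equivariant : ∀ τ ∈ FiberBundle.trivializationAtlas (SpC n) P, ∀ x ∈ τ.baseSet,
    ∀ (p : P x) (g : SpC n), (τ ⟨x, p <• g⟩).2 = (τ ⟨x, p⟩).2 * g
  holomorphic : ∀ τ ∈ FiberBundle.trivializationAtlas (SpC n) P,
    ∀ τ' ∈ FiberBundle.trivializationAtlas (SpC n) P, ∀ x ∈ τ.baseSet ∩ τ'.baseSet,
      HolGroupAt (fun y => (τ' (τ.toOpenPartialHomeomorph.symm (y, 1))).2) x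

variable {P}

/-- The section `s` of a holomorphic principal bundle is holomorphic in a neighbourhood of `x`. -/
def HolPSectionAt (s : ∀ y, P y) (x : X) : Prop :=
  HolGroupAt (fun y => (trivializationAt (SpC n) P x ⟨y, s y⟩).2) x

variable (P) in
/-- A holomorphic principal connection `ω`: a holomorphic connection one-form with values in
`𝔤 = 𝔰𝔭(2n, ℂ)`, given by its pullbacks `s^*ω` under the local holomorphic sections `s` of `P`.
(Only the values of `pullback s x` where `s` is holomorphic near `x` have a meaning.) The pullbacks
are holomorphic one-forms and satisfy the rule `(s g)^*ω = Ad(g⁻¹) s^*ω + g⁻¹ dg`. -/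
structure PrincipalConnection [IsManifold 𝓘(ℂ) ω X] where
  pullback : (∀ y, P y) → ∀ x : X, TangentSpace 𝓘(ℂ) x →ₗ[ℂ] Mat n
  mem_lie : ∀ s x, HolPSectionAt n s x → ∀ ξ, pullback s x ξ ∈ spLie n
  holomorphic : ∀ s x, HolPSectionAt n s x → ∀ V, HolVectorFieldAt V x →
    ∀ i j, HolAt (fun y => pullback s y (V y) i j) x
  gauge : ∀ s x, HolPSectionAt n s x → ∀ g : X → SpC n, HolGroupAt g x → ∀ ξ,
    pullback (fun y => s y <• g y) x ξ =
      Ad (g x)⁻¹ (pullback s x ξ) + ((g x)⁻¹ : SpC n) * dGroup g x ξ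

variable {n} in
/-- `Q` is a holomorphic reduction of the structure group of `P` to the subgroup `H`: it meets each
fibre in an orbit of `H`, and holomorphic local sections of `P` with values in `Q` exist near every
point. -/
structure IsReduction (H : Subgroup (SpC n)) (Q : ∀ x, Set (P x)) : Prop where
  orbit : ∀ x, ∀ p ∈ Q x, ∀ g : SpC n, p <• g ∈ Q x ↔ g ∈ H
  exists_section : ∀ x, ∃ s : ∀ y, P y, HolPSectionAt n s x ∧ ∀ᶠ y in 𝓝 x, s y ∈ Q y

end Principal

/-! ## `(G, P)`-opers -/

variable (X) in
/-- An `(Sp(2n, ℂ), P)`-oper on `X` associated to the `𝔰𝔩₂`-triple `(f, h, e)` (`e` is not needed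
to define it), where `P` is the parabolic subgroup of the triple: a holomorphic principal bundle, a
holomorphic reduction `Q` of it to `P`, and a holomorphic principal connection whose second
fundamental form, i.e. the restriction of the connection form to `Q` taken modulo `𝔭`, takes
values in the orbit of `f` under `P` in `𝔤/𝔭` (on all nonzero tangent vectors of `X`). -/
structure GPOper [IsManifold 𝓘(ℂ) ω X] {n : ℕ} (f h : Mat n) where
  P : X → Type v
  [topTotal : TopologicalSpace (TotalSpace (SpC n) P)]
  [topFibre : ∀ x, TopologicalSpace (P x)]
  [fiberBundle : FiberBundle (SpC n) P]
  [action : ∀ x, MulAction (SpC n)ᵐᵒᵖ (P x)]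
  [principal : IsHolPrincipalBundle n P]
  Q : ∀ x, Set (P x)
  reduction : IsReduction (parabolic h) Q
  conn : PrincipalConnection n P
  oper : ∀ s x, HolPSectionAt n s x → (∀ᶠ y in 𝓝 x, s y ∈ Q y) →
    ∀ ξ : TangentSpace 𝓘(ℂ) x, ξ ≠ 0 →
      ∃ g ∈ parabolic h, conn.pullback s x ξ - Ad g f ∈ parabolicLie h

attribute [instance] GPOper.topTotal GPOper.topFibre GPOper.fiberBundle GPOper.action
  GPOper.principal

/-- Isomorphisms of `(G, P)`-opers: isomorphisms of holomorphic principal bundles that match the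
reductions and the connections. -/
@[ext]
structure GPOper.Iso [IsManifold 𝓘(ℂ) ω X] {n : ℕ} {f h : Mat n} (A B : GPOper.{u, v} X f h) where
  toEquiv : ∀ x, A.P x ≃ B.P x
  equivariant : ∀ x (p : A.P x) (g : SpC n), toEquiv x (p <• g) = toEquiv x p <• g
  holomorphic : ∀ s x, HolPSectionAt n (fun y => toEquiv y (s y)) x ↔ HolPSectionAt n s x
  map_reduction : ∀ x p, toEquiv x p ∈ B.Q x ↔ p ∈ A.Q x
  map_conn : ∀ s x, HolPSectionAt n s x →
    B.conn.pullback (fun y => toEquiv y (s y)) x = A.conn.pullback s x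

/-- The groupoid of `(G, P)`-opers. -/
instance [IsManifold 𝓘(ℂ) ω X] {n : ℕ} (f h : Mat n) : Category (GPOper.{u, v} X f h) where
  Hom A B := GPOper.Iso A B
  id A :=
    { toEquiv := fun x => Equiv.refl _
      equivariant := fun _ _ _ => rfl
      holomorphic := fun _ _ => Iff.rfl
      map_reduction := fun _ _ => Iff.rfl
      map_conn := fun _ _ _ => rfl }
  comp {A B C} a b :=
    { toEquiv := fun x => (a.toEquiv x).trans (b.toEquiv x)
      equivariant := fun x p g => by simp [a.equivariant, b.equivariant]
      holomorphic := fun s x =>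
        (b.holomorphic (fun y => a.toEquiv y (s y)) x).trans (a.holomorphic s x)
      map_reduction := fun x p => (b.map_reduction x _).trans (a.map_reduction x p)
      map_conn := fun s x hs =>
        (b.map_conn (fun y => a.toEquiv y (s y)) x ((a.holomorphic s x).2 hs)).trans
          (a.map_conn s x hs) }

variable (X) in
/-- `Θ`-positive opers for `G = Sp(2n, ℂ)` and `Θ = {αₙ}`: the `(G, P)`-opers associated to the
(complexified) `Θ`-principal triple `(f, h, e)`. -/
abbrev ThetaPositiveOper [IsManifold 𝓘(ℂ) ω X] {n : ℕ} {f h e : RMat n}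
    (_ : IsThetaPrincipalTriple f h e) : Type (max u (v + 1)) :=
  GPOper.{u, v} X (complexify f) (complexify h)

/-! ## Generalized `B`-opers -/

section Vector

variable (n : ℕ) {E : X → Type v} [∀ x, AddCommGroup (E x)] [∀ x, Module ℂ (E x)]
  [TopologicalSpace (TotalSpace (Std n) E)] [∀ x, TopologicalSpace (E x)] [FiberBundle (Std n) E]

/-- The section `s` of the vector bundle `E` is holomorphic in a neighbourhood of `x`. -/
def HolSectionAt (s : ∀ y, E y) (x : X) : Prop :=
  ContMDiffAt 𝓘(ℂ) (𝓘(ℂ).prod 𝓘(ℂ, Std n)) ω (fun y => TotalSpace.mk' (Std n) y (s y)) x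

/-- A holomorphic symplectic form on the vector bundle `E`. -/
structure IsSymplecticForm (B : ∀ x, E x →ₗ[ℂ] E x →ₗ[ℂ] ℂ) : Prop where
  alt : ∀ x, (B x).IsAlt
  nondegenerate : ∀ x, (B x).Nondegenerate
  holomorphic : ∀ s t x, HolSectionAt n s x → HolSectionAt n t x → HolAt (fun y => B y (s y) (t y)) x

/-- `F` is a holomorphic subbundle of rank `r`: it has holomorphic frames near every point. -/
def IsSubbundle (r : ℕ) (F : ∀ x, Submodule ℂ (E x)) : Prop :=
  ∀ x, ∃ s : Fin r → ∀ y, E y, (∀ i, HolSectionAt n (s i) x) ∧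
    ∀ᶠ y in 𝓝 x, LinearIndependent ℂ (fun i => s i y) ∧
      Submodule.span ℂ (Set.range fun i => s i y) = F y

variable [∀ x, IsTopologicalAddGroup (E x)] [∀ x, ContinuousSMul ℂ (E x)]

/-- The connection `D` is holomorphic: on every open set it takes holomorphic sections of `E` to
holomorphic sections of `E ⊗ K = Hom(TX, E)`. -/
def IsHolConnection [IsManifold 𝓘(ℂ) ω X] [VectorBundle ℂ (Std n) E]
    (D : CovariantDerivative 𝓘(ℂ) (Std n) E) : Prop :=
  ∀ U : Set X, IsOpen U → ContMDiffCovariantDerivativeOn (Std n) ω D U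

/-- Compatibility of the connection `D` with the form `B`, i.e.
`d(B(s, t)) = B(D s, t) + B(s, D t)` for holomorphic local sections. -/
def IsCompatible (B : ∀ x, E x →ₗ[ℂ] E x →ₗ[ℂ] ℂ) (D : CovariantDerivative 𝓘(ℂ) (Std n) E) : Prop :=
  ∀ s t x, HolSectionAt n s x → HolSectionAt n t x → ∀ ξ : TangentSpace 𝓘(ℂ) x,
    mvfderiv 𝓘(ℂ) (fun y => B y (s y) (t y)) x ξ = B x (D s x ξ) (t x) + B x (s x) (D t x ξ)

/-- The second fundamental form of `D` with respect to the subbundle `F` induces an isomorphism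
`S : F → (E/F) ⊗ K = Hom(TX, E/F)`, `s ↦ D s mod F`. -/
def HasSecondFundamentalIso (F : ∀ x, Submodule ℂ (E x))
    (D : CovariantDerivative 𝓘(ℂ) (Std n) E) : Prop :=
  ∀ x, ∃ S : F x ≃ₗ[ℂ] (TangentSpace 𝓘(ℂ) x →ₗ[ℂ] E x ⧸ F x),
    ∀ s, HolSectionAt n s x → ∀ hs : ∀ᶠ y in 𝓝 x, s y ∈ F y,
      ∀ ξ, S ⟨s x, hs.self_of_nhds⟩ ξ = (F x).mkQ (D s x ξ)

end Vector

variable (X) in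
/-- A generalized `B`-oper `(E, {F₁ ⊂ F₂ = E}, D)` of filtration length `2`, with `E` of rank `2n`
with a holomorphic symplectic form `B`, and `F₁` of rank `n`. The filtration is a `B`-filtration:
`F₁^⊥ = F₁`. The connection `D` is a `B`-connection (Griffiths transversality
`D(F₁) ⊂ F₂ ⊗ K = E ⊗ K` is void), and its second fundamental form is an isomorphism
`F₁ ≃ (F₂/F₁) ⊗ K`. -/
structure BOper [IsManifold 𝓘(ℂ) ω X] (n : ℕ) where
  E : X → Type v
  [addCommGroup : ∀ x, AddCommGroup (E x)]
  [module : ∀ x, Module ℂ (E x)]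
  [topTotal : TopologicalSpace (TotalSpace (Std n) E)]
  [topFibre : ∀ x, TopologicalSpace (E x)]
  [topAddGroup : ∀ x, IsTopologicalAddGroup (E x)]
  [continuousSMul : ∀ x, ContinuousSMul ℂ (E x)]
  [fiberBundle : FiberBundle (Std n) E]
  [vectorBundle : VectorBundle ℂ (Std n) E]
  [holomorphic : ContMDiffVectorBundle ω (Std n) E 𝓘(ℂ)]
  B : ∀ x, E x →ₗ[ℂ] E x →ₗ[ℂ] ℂ
  symplectic : IsSymplecticForm n B
  F₁ : ∀ x, Submodule ℂ (E x)
  subbundle : IsSubbundle n n F₁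
  orthogonal : ∀ x w, w ∈ F₁ x ↔ ∀ v ∈ F₁ x, B x w v = 0
  D : CovariantDerivative 𝓘(ℂ) (Std n) E
  holConnection : IsHolConnection n D
  compatible : IsCompatible n B D
  nondegenerate : HasSecondFundamentalIso n F₁ D

attribute [instance] BOper.addCommGroup BOper.module BOper.topTotal BOper.topFibre
  BOper.topAddGroup BOper.continuousSMul BOper.fiberBundle BOper.vectorBundle BOper.holomorphic

/-- Isomorphisms of generalized `B`-opers: isomorphisms of holomorphic vector bundles that match
the symplectic forms, the filtrations and the connections. -/
@[ext]
structure BOper.Iso [IsManifold 𝓘(ℂ) ω X] {n : ℕ} (A C : BOper.{u, v} X n) where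
  toEquiv : ∀ x, A.E x ≃ₗ[ℂ] C.E x
  holomorphic : ∀ s x, HolSectionAt n (fun y => toEquiv y (s y)) x ↔ HolSectionAt n s x
  map_form : ∀ x v w, C.B x (toEquiv x v) (toEquiv x w) = A.B x v w
  map_filtration : ∀ x v, toEquiv x v ∈ C.F₁ x ↔ v ∈ A.F₁ x
  map_conn : ∀ s x, HolSectionAt n s x → ∀ ξ,
    C.D (fun y => toEquiv y (s y)) x ξ = toEquiv x (A.D s x ξ)

/-- The groupoid of generalized `B`-opers. -/
instance [IsManifold 𝓘(ℂ) ω X] (n : ℕ) : Category (BOper.{u, v} X n) where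
  Hom A C := BOper.Iso A C
  id A :=
    { toEquiv := fun x => LinearEquiv.refl ℂ _
      holomorphic := fun _ _ => Iff.rfl
      map_form := fun _ _ _ => rfl
      map_filtration := fun _ _ => Iff.rfl
      map_conn := fun _ _ _ _ => rfl }
  comp {A B C} a b :=
    { toEquiv := fun x => (a.toEquiv x).trans (b.toEquiv x)
      holomorphic := fun s x =>
        (b.holomorphic (fun y => a.toEquiv y (s y)) x).trans (a.holomorphic s x)
      map_form := fun x v w => (b.map_form x _ _).trans (a.map_form x v w)
      map_filtration := fun x v => (b.map_filtration x _).trans (a.map_filtration x v)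
      map_conn := fun s x hs ξ =>
        (b.map_conn (fun y => a.toEquiv y (s y)) x ((a.holomorphic s x).2 hs) ξ).trans
          (congrArg _ (a.map_conn s x hs ξ)) }

/-! ## The associated bundle -/

/-- The Lagrangian subspace `ℂⁿ ⊕ 0` of `ℂ²ⁿ`. -/
def stdLagrangian (n : ℕ) : Submodule ℂ (Std n) :=
  LinearMap.ker (LinearMap.funLeft ℂ ℂ (Sum.inr : Fin n → Fin n ⊕ Fin n))

/-- An identification of the data `𝓔 = (E, B, F₁, D)` with the data induced by
`𝓟 = (P_G, P_P, ω)` on the associated bundle `P_G ×_G ℂ²ⁿ`: a family of linear isomorphisms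
`v ↦ [p, v]` from `ℂ²ⁿ` to `E_x`, for `p` in the fibre of `P_G` at `x`, with `[p g, v] = [p, g v]`,
holomorphic, such that `B` is induced by the standard symplectic form, `P_P` consists of
the `p` that take the standard Lagrangian to `F₁`, and `D` is induced by `ω`. -/
structure Association [IsManifold 𝓘(ℂ) ω X] {n : ℕ} {f h : Mat n} (𝓟 : GPOper.{u, v} X f h)
    (𝓔 : BOper.{u, v} X n) where
  frame : ∀ x, 𝓟.P x → (Std n ≃ₗ[ℂ] 𝓔.E x)
  equivariant : ∀ x p (g : SpC n) v, frame x (p <• g) v = frame x p ((g : Mat n) *ᵥ v)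
  holomorphic : ∀ s x, HolPSectionAt n s x → ∀ v, HolSectionAt n (fun y => frame y (s y) v) x
  form : ∀ x p v w, 𝓔.B x (frame x p v) (frame x p w) = v ⬝ᵥ (J (Fin n) ℂ *ᵥ w)
  filtration : ∀ x p, p ∈ 𝓟.Q x ↔ (stdLagrangian n).map (frame x p).toLinearMap = 𝓔.F₁ x
  conn : ∀ s x, HolPSectionAt n s x → ∀ v ξ,
    𝓔.D (fun y => frame y (s y) v) x ξ = frame x (s x) (𝓟.conn.pullback s x ξ *ᵥ v)

end Opers

/-!
Two observations reduce the equivalence to linear algebra in the fibres.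

The triple. The element `e` is an invertible symmetric block `S` in the upper right corner and
`f = eᵀ`, so `[h, e] = 2e` with `h = [e, f]` gives `S³ = S`, hence `S² = 1` and `h = diag(1, -1)`
(`IsThetaPrincipalTriple.exists_block`). Therefore `𝔭` is the set of block upper triangular elements
of `𝔰𝔭`, and `P_Θ`, the normalizer of `𝔲`, is the stabilizer of the Lagrangian `ℂⁿ ⊕ 0`, which is the
common kernel of `𝔲` (`mem_parabolic_iff`). The class of `x ∈ 𝔰𝔭` in `𝔤/𝔭` is its symmetric lower left
block, the Levi factor `GL_n` acts on it by congruence, and all invertible complex symmetric matrices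
are congruent. So the orbit `P_Θ · f` consists of the classes with invertible lower left block
(`exists_mem_parabolic_iff`). In a section of the reduction this block of the connection form is the
second fundamental form of `F₁`, so the two nondegeneracy conditions agree.

The frames. If `E` is associated to `P`, then `p ↦ (v ↦ [p, v])` identifies each fibre of `P` with the
symplectic frames of the fibre of `E`; holomorphic sections, the reduction and the connection of
either side can be read off from those of the other (`Association.toFrame_bijective`,
`Association.holPSectionAt_iff`, `Association.conn_apply`). Hence for any two associated pairs the
isomorphisms of opers correspond to the isomorphisms of generalized `B`-opers
(`Association.exists_map`, `Association.exists_lift`), and the functor is fully faithful as soon as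
every oper has an associated bundle.

It remains to construct, for each object on one side, an associated object on the other. The bundle
`P ×_G ℂ²ⁿ` is glued from the frames given by local sections of `P`, with `D = d + s^*ω` in the frame
of `s` (`GPOper.assocOper`, `GPOper.association`). Conversely, `E` is associated to its bundle of
symplectic frames, reduced to the frames taking `ℂⁿ ⊕ 0` to `F₁`; these exist locally by a
holomorphic Gram-Schmidt procedure, which completes a frame of the Lagrangian `F₁` to a symplectic
one (`BOper.exists_adaptedFrame`, `BOper.frameOper`, `BOper.association`).
-/

set_option linter.unusedSectionVars false

namespace Opers

attribute [local instance] LieRing.ofAssociativeRing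

/-! ### Holomorphic functions and matrices -/

section Calculus

variable {X : Type u} [TopologicalSpace X] [ChartedSpace ℂ X] {x : X}

namespace HolAt

variable {φ ψ : X → ℂ}

theorem const (c : ℂ) : HolAt (fun _ : X => c) x := contMDiffAt_const

theorem congr (h : HolAt φ x) (e : ∀ᶠ y in 𝓝 x, ψ y = φ y) : HolAt ψ x :=
  ContMDiffAt.congr_of_eventuallyEq h e

theorem add (h : HolAt φ x) (k : HolAt ψ x) : HolAt (fun y => φ y + ψ y) x :=
  ContMDiffAt.add h k

theorem neg (h : HolAt φ x) : HolAt (fun y => -φ y) x :=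
  ContMDiffAt.neg h

theorem mul (h : HolAt φ x) (k : HolAt ψ x) : HolAt (fun y => φ y * ψ y) x :=
  ContMDiffAt.mul h k

theorem sum {ι : Type*} {s : Finset ι} {f : ι → X → ℂ} (h : ∀ i ∈ s, HolAt (f i) x) :
    HolAt (fun y => ∑ i ∈ s, f i y) x := by
  exact ContMDiffAt.sum h

theorem prod {ι : Type*} {s : Finset ι} {f : ι → X → ℂ} (h : ∀ i ∈ s, HolAt (f i) x) :
    HolAt (fun y => ∏ i ∈ s, f i y) x := by
  exact contMDiffAt_finsetProd h

theorem inv (h : HolAt φ x) (h0 : φ x ≠ 0) : HolAt (fun y => (φ y)⁻¹) x :=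
  ContMDiffAt.inv₀ h h0

theorem mdifferentiableAt (h : HolAt φ x) : MDifferentiableAt 𝓘(ℂ) 𝓘(ℂ) φ x :=
  ContMDiffAt.mdifferentiableAt h (by simp)

theorem continuousAt (h : HolAt φ x) : ContinuousAt φ x :=
  ContMDiffAt.continuousAt h

theorem eventually [IsManifold 𝓘(ℂ) ω X] (h : HolAt φ x) : ∀ᶠ y in 𝓝 x, HolAt φ y :=
  (contMDiffAt_iff_contMDiffAt_nhds (by simp)).1 h

end HolAt

theorem HolAt.det {ι : Type*} [Fintype ι] [DecidableEq ι] {M : X → Matrix ι ι ℂ}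
    (h : ∀ i j, HolAt (fun y => M y i j) x) : HolAt (fun y => (M y).det) x := by
  simp only [Matrix.det_apply']
  exact HolAt.sum fun σ _ => (HolAt.const _).mul (HolAt.prod fun i _ => h _ _)

theorem HolAt.adjugate {ι : Type*} [Fintype ι] [DecidableEq ι] {M : X → Matrix ι ι ℂ}
    (h : ∀ i j, HolAt (fun y => M y i j) x) (i j : ι) :
    HolAt (fun y => (M y).adjugate i j) x := by
  simp only [Matrix.adjugate_apply]
  refine HolAt.det fun k l => ?_
  by_cases hk : k = j
  · subst hk
    simpa using HolAt.const _
  · simpa [Matrix.updateRow_ne hk] using h k l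

/-- The inverse of an invertible holomorphic matrix is holomorphic. -/
theorem HolAt.matrix_inv {ι : Type*} [Fintype ι] [DecidableEq ι] {M : X → Matrix ι ι ℂ}
    (h : ∀ i j, HolAt (fun y => M y i j) x) (h0 : (M x).det ≠ 0) (i j : ι) :
    HolAt (fun y => (M y)⁻¹ i j) x := by
  simp only [Matrix.inv_def, Ring.inverse_eq_inv', Matrix.smul_apply, smul_eq_mul]
  exact ((HolAt.det h).inv h0).mul (HolAt.adjugate h i j)

theorem contMDiffAt_pi_iff_holAt {ι : Type*} [Fintype ι] {φ : X → ι → ℂ} :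
    ContMDiffAt 𝓘(ℂ) 𝓘(ℂ, ι → ℂ) ω φ x ↔ ∀ i, HolAt (fun y => φ y i) x :=
  contMDiffAt_pi_space

theorem mdifferentiableAt_pi_iff {ι : Type*} [Fintype ι] {φ : X → ι → ℂ} :
    MDifferentiableAt 𝓘(ℂ) 𝓘(ℂ, ι → ℂ) φ x ↔
      ∀ i, MDifferentiableAt 𝓘(ℂ) 𝓘(ℂ) (fun y => φ y i) x := by
  simp only [mdifferentiableAt_iff, continuousAt_pi]
  constructor
  · rintro ⟨h, k⟩ i
    exact ⟨h i, (differentiableWithinAt_pi.1 k) i⟩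
  · intro h
    exact ⟨fun i => (h i).1, differentiableWithinAt_pi.2 fun i => (h i).2⟩

/-- The derivative of a holomorphic function along a holomorphic vector field is holomorphic. -/
theorem HolAt.mvfderiv_apply [IsManifold 𝓘(ℂ) ω X] {φ : X → ℂ} (h : HolAt φ x)
    {V : ∀ y : X, TangentSpace 𝓘(ℂ) y} (hV : HolVectorFieldAt V x) :
    HolAt (fun y => mvfderiv 𝓘(ℂ) φ y (V y)) x := by
  obtain ⟨u, hu, hφ⟩ := (contMDiffAt_iff_contMDiffOn_nhds (n := ω) (by simp)).1 h
  obtain ⟨w, hwu, hw, hxw⟩ := mem_nhds_iff.1 hu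
  have h1 := (hφ.mono hwu).contMDiffOn_tangentMapWithin (m := ω) (by simp) hw.uniqueMDiffOn
  have h2 := (h1.contMDiffAt (x := ⟨x, V x⟩)
    ((hw.preimage (FiberBundle.continuous_proj ℂ (TangentSpace 𝓘(ℂ)))).mem_nhds hxw))
  have h3 := h2.comp x hV
  rw [contMDiffAt_totalSpace] at h3
  refine HolAt.congr h3.2 ?_
  filter_upwards [hw.mem_nhds hxw] with y hy
  simp [tangentMapWithin, mvfderiv, mfderivWithin_of_isOpen hw hy]
  rfl

end Calculus

section LinearAlgebra

variable {n : ℕ}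

/-! ### The standard Lagrangian and the symplectic group -/

theorem mem_stdLagrangian {v : Std n} : v ∈ stdLagrangian n ↔ ∀ i, v (Sum.inr i) = 0 := by
  simp [stdLagrangian, LinearMap.mem_ker, funext_iff, LinearMap.funLeft_apply]

theorem finrank_stdLagrangian : Module.finrank ℂ (stdLagrangian n) = n := by
  have h := LinearMap.finrank_range_add_finrank_ker
    (LinearMap.funLeft ℂ ℂ (Sum.inr : Fin n → Fin n ⊕ Fin n))
  rw [LinearMap.range_eq_top.2 (LinearMap.funLeft_surjective_of_injective ℂ ℂ _ Sum.inr_injective)]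
    at h
  simp at h
  exact h

theorem symplectic_inv_mul (g : SpC n) : ((g⁻¹ : SpC n) : Mat n) * (g : Mat n) = 1 := by
  rw [← Submonoid.coe_mul, inv_mul_cancel, Submonoid.coe_one]

theorem symplectic_mul_inv (g : SpC n) : (g : Mat n) * ((g⁻¹ : SpC n) : Mat n) = 1 := by
  rw [← Submonoid.coe_mul, mul_inv_cancel, Submonoid.coe_one]

theorem symplectic_inv_mulVec_mulVec (g : SpC n) (v : Std n) :
    ((g⁻¹ : SpC n) : Mat n) *ᵥ ((g : Mat n) *ᵥ v) = v := by
  rw [mulVec_mulVec, symplectic_inv_mul, one_mulVec]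

theorem symplectic_mulVec_inv_mulVec (g : SpC n) (v : Std n) :
    (g : Mat n) *ᵥ (((g⁻¹ : SpC n) : Mat n) *ᵥ v) = v := by
  rw [mulVec_mulVec, symplectic_mul_inv, one_mulVec]

/-- The standard symplectic form in blocks. -/
theorem dotProduct_J_mulVec (v w : Std n) :
    v ⬝ᵥ (J (Fin n) ℂ *ᵥ w) =
      ∑ i, (v (Sum.inr i) * w (Sum.inl i) - v (Sum.inl i) * w (Sum.inr i)) := by
  simp only [J, dotProduct, Fintype.sum_sum_type, fromBlocks_mulVec, Sum.elim_inl, Sum.elim_inr,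
    zero_mulVec, neg_mulVec, one_mulVec, zero_add, add_zero, Pi.neg_apply, Function.comp,
    Finset.sum_sub_distrib]
  simp
  ring

theorem mem_symplecticGroup_iff_form {A : Mat n} :
    A ∈ symplecticGroup (Fin n) ℂ ↔ ∀ v w : Std n,
      (A *ᵥ v) ⬝ᵥ (J (Fin n) ℂ *ᵥ (A *ᵥ w)) = v ⬝ᵥ (J (Fin n) ℂ *ᵥ w) := by
  have key : ∀ v w : Std n, (A *ᵥ v) ⬝ᵥ (J (Fin n) ℂ *ᵥ (A *ᵥ w)) =
      v ⬝ᵥ ((Aᵀ * J (Fin n) ℂ * A) *ᵥ w) := by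
    intro v w
    rw [← vecMul_transpose, ← dotProduct_mulVec, mulVec_mulVec, mulVec_mulVec]
  rw [← SymplecticGroup.transpose_mem_iff, SymplecticGroup.mem_iff, transpose_transpose]
  simp only [key]
  constructor
  · intro h v w
    rw [h]
  · intro h
    ext i j
    simpa using h (Pi.single i 1) (Pi.single j 1)

theorem symplectic_form (g : SpC n) (v w : Std n) :
    ((g : Mat n) *ᵥ v) ⬝ᵥ (J (Fin n) ℂ *ᵥ ((g : Mat n) *ᵥ w)) = v ⬝ᵥ (J (Fin n) ℂ *ᵥ w) :=
  mem_symplecticGroup_iff_form.1 g.2 v w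

/-- The standard symplectic form is nondegenerate. -/
theorem eq_zero_of_dotProduct_J {v : Std n} (h : ∀ w, v ⬝ᵥ (J (Fin n) ℂ *ᵥ w) = 0) : v = 0 := by
  simp only [dotProduct_J_mulVec] at h
  ext (i | i)
  · simpa [Pi.single_apply] using h (Pi.single (Sum.inr i) 1)
  · simpa [Pi.single_apply] using h (Pi.single (Sum.inl i) 1)

/-- The subspace `ℂⁿ ⊕ 0` is its own orthogonal. -/
theorem mem_stdLagrangian_iff_orthogonal {w : Std n} :
    w ∈ stdLagrangian n ↔ ∀ v ∈ stdLagrangian n, w ⬝ᵥ (J (Fin n) ℂ *ᵥ v) = 0 := by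
  constructor
  · intro hw v hv
    rw [mem_stdLagrangian] at hw hv
    simp [dotProduct_J_mulVec, hw, hv]
  · intro h
    rw [mem_stdLagrangian]
    intro i
    have := h (Pi.single (Sum.inl i) 1) (by simp [mem_stdLagrangian])
    rw [dotProduct_J_mulVec] at this
    simpa [Pi.single_apply] using this

theorem mem_spLie_iff_mul {x : Mat n} :
    x ∈ spLie n ↔ xᵀ * J (Fin n) ℂ = -(J (Fin n) ℂ * x) := by
  rw [spLie, LieAlgebra.Symplectic.sp, mem_skewAdjointMatricesLieSubalgebra,
    mem_skewAdjointMatricesSubmodule, Matrix.IsSkewAdjoint, Matrix.IsAdjointPair, mul_neg]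

theorem mem_spLie_iff_form {x : Mat n} :
    x ∈ spLie n ↔ ∀ v w : Std n,
      (x *ᵥ v) ⬝ᵥ (J (Fin n) ℂ *ᵥ w) + v ⬝ᵥ (J (Fin n) ℂ *ᵥ (x *ᵥ w)) = 0 := by
  have key : ∀ v w : Std n,
      (x *ᵥ v) ⬝ᵥ (J (Fin n) ℂ *ᵥ w) + v ⬝ᵥ (J (Fin n) ℂ *ᵥ (x *ᵥ w)) =
        v ⬝ᵥ ((xᵀ * J (Fin n) ℂ + J (Fin n) ℂ * x) *ᵥ w) := by
    intro v w
    rw [← vecMul_transpose, ← dotProduct_mulVec, mulVec_mulVec, mulVec_mulVec, add_mulVec,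
      dotProduct_add]
  rw [mem_spLie_iff_mul, eq_neg_iff_add_eq_zero]
  simp only [key]
  constructor
  · intro h v w
    simp [h]
  · intro h
    ext i j
    simpa using h (Pi.single i 1) (Pi.single j 1)

theorem mem_spLie_iff_blocks {x : Mat n} :
    x ∈ spLie n ↔ x.toBlocks₁₂ᵀ = x.toBlocks₁₂ ∧ x.toBlocks₂₁ᵀ = x.toBlocks₂₁ ∧
      x.toBlocks₂₂ = -x.toBlocks₁₁ᵀ := by
  obtain ⟨A, B, C, D, rfl⟩ : ∃ A B C D, x = fromBlocks A B C D := ⟨_, _, _, _, (fromBlocks_toBlocks x).symm⟩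
  rw [mem_spLie_iff_mul]
  simp only [J, fromBlocks_transpose, fromBlocks_multiply, fromBlocks_neg, toBlocks_fromBlocks₁₁,
    toBlocks_fromBlocks₁₂, toBlocks_fromBlocks₂₁, toBlocks_fromBlocks₂₂, fromBlocks_inj]
  simp
  constructor
  · rintro ⟨h1, h2, h3, h4⟩
    refine ⟨h4, h1, ?_⟩
    rw [← transpose_transpose D, h3, transpose_neg]
  · rintro ⟨h1, h2, h3⟩
    subst h3
    simp [h1, h2]

/-- A matrix preserves `ℂⁿ ⊕ 0` if and only if its lower left block vanishes. -/
theorem toBlocks₂₁_eq_zero_iff {x : Mat n} :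
    x.toBlocks₂₁ = 0 ↔ ∀ v ∈ stdLagrangian n, x *ᵥ v ∈ stdLagrangian n := by
  constructor
  · intro h v hv
    rw [mem_stdLagrangian] at hv ⊢
    intro i
    have : ∀ j, x (Sum.inr i) (Sum.inl j) = 0 := fun j => congrFun (congrFun h i) j
    simp [mulVec, dotProduct, Fintype.sum_sum_type, this, hv]
  · intro h
    ext i j
    have := mem_stdLagrangian.1 (h (Pi.single (Sum.inl j) 1) (by simp [mem_stdLagrangian])) i
    simpa [toBlocks₂₁] using this

theorem mulVec_inr_of_mem_stdLagrangian (x : Mat n) {v : Std n} (hv : v ∈ stdLagrangian n)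
    (i : Fin n) : (x *ᵥ v) (Sum.inr i) = (x.toBlocks₂₁ *ᵥ fun j => v (Sum.inl j)) i := by
  rw [mem_stdLagrangian] at hv
  simp [mulVec, dotProduct, Fintype.sum_sum_type, hv, toBlocks₂₁]

/-- The lower left block of `x` is invertible if and only if `x` takes no nonzero vector of
`ℂⁿ ⊕ 0` into `ℂⁿ ⊕ 0`. -/
theorem det_toBlocks₂₁_ne_zero_iff {x : Mat n} :
    x.toBlocks₂₁.det ≠ 0 ↔ ∀ v ∈ stdLagrangian n, x *ᵥ v ∈ stdLagrangian n → v = 0 := by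
  rw [Ne, ← Matrix.exists_mulVec_eq_zero_iff]
  push Not
  constructor
  · intro h v hv hxv
    by_contra hne
    refine h (fun j => v (Sum.inl j)) (fun h0 => hne ?_) ?_
    · ext (i | i)
      · exact congrFun h0 i
      · exact mem_stdLagrangian.1 hv i
    · ext i
      rw [← mulVec_inr_of_mem_stdLagrangian x hv]
      exact mem_stdLagrangian.1 hxv i
  · intro h w hw hxw
    have hv : (Sum.elim w 0 : Std n) ∈ stdLagrangian n := by simp [mem_stdLagrangian]
    refine hw ?_
    have h0 := h _ hv (mem_stdLagrangian.2 fun i => by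
      rw [mulVec_inr_of_mem_stdLagrangian x hv]
      exact congrFun hxw i)
    ext i
    exact congrFun h0 (Sum.inl i)

/-! ### The triple -/

/-- The semisimple element `diag(1, -1)` of every `Θ`-principal triple. It acts on `ℂⁿ ⊕ 0` by `1`
and on `0 ⊕ ℂⁿ` by `-1`. -/
def gradingElement (n : ℕ) : Mat n := fromBlocks 1 0 0 (-1)

/-- The nilradical `𝔲_Θ` lies in the upper right block: a matrix unit in one of the other blocks has a
weight whose coordinates sum to `0` or `-2`, whereas the coordinates of a root involving the long
simple root have positive sum. -/
theorem IsThetaPrincipalTriple.toBlocks_e {f h e : RMat n} (t : IsThetaPrincipalTriple f h e) :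
    e = fromBlocks 0 e.toBlocks₁₂ 0 0 := by
  let U : Submodule ℝ (RMat n) :=
    { carrier := {x | x.toBlocks₁₁ = 0 ∧ x.toBlocks₂₁ = 0 ∧ x.toBlocks₂₂ = 0}
      add_mem' := by
        rintro x y ⟨h1, h2, h3⟩ ⟨k1, k2, k3⟩
        simp only [Set.mem_ofPred_eq] at *
        refine ⟨?_, ?_, ?_⟩
        · rw [show (x + y).toBlocks₁₁ = x.toBlocks₁₁ + y.toBlocks₁₁ from rfl, h1, k1, add_zero]
        · rw [show (x + y).toBlocks₂₁ = x.toBlocks₂₁ + y.toBlocks₂₁ from rfl, h2, k2, add_zero]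
        · rw [show (x + y).toBlocks₂₂ = x.toBlocks₂₂ + y.toBlocks₂₂ from rfl, h3, k3, add_zero]
      zero_mem' := ⟨rfl, rfl, rfl⟩
      smul_mem' := by
        rintro c x ⟨h1, h2, h3⟩
        simp only [Set.mem_ofPred_eq] at *
        refine ⟨?_, ?_, ?_⟩
        · rw [show (c • x).toBlocks₁₁ = c • x.toBlocks₁₁ from rfl, h1, smul_zero]
        · rw [show (c • x).toBlocks₂₁ = c • x.toBlocks₂₁ from rfl, h2, smul_zero]
        · rw [show (c • x).toBlocks₂₂ = c • x.toBlocks₂₂ from rfl, h3, smul_zero] }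
  have hU : thetaNilradical (longRoot n) ≤ U := by
    classical
    refine iSup₂_le fun μ hμ x hx => ?_
    obtain ⟨⟨-, -, c, hc⟩, hspan⟩ := hμ
    -- the sum of the coordinates of a root is twice its coefficient at the long simple root
    have hroot : ∀ i : Fin n, simpleRoot i ⬝ᵥ (1 : Fin n → ℝ) = if i ∈ longRoot n then 2 else 0 := by
      intro i
      by_cases hi : i.val + 1 < n
      · have : i ∉ longRoot n := fun h => absurd (show i.val + 1 = n from h) hi.ne
        simp [simpleRoot, hi, this]
      · have : i ∈ longRoot n := show i.val + 1 = n by omega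
        simp [simpleRoot, hi, this]
    have hsum : μ ⬝ᵥ (1 : Fin n → ℝ) = ∑ i, (c i : ℝ) * if i ∈ longRoot n then 2 else 0 := by
      rw [hc, sum_dotProduct]
      refine Finset.sum_congr rfl fun i _ => ?_
      rw [smul_dotProduct, hroot, nsmul_eq_mul]
    obtain ⟨i, hi, hci⟩ : ∃ i ∈ longRoot n, c i ≠ 0 := by
      by_contra! hcon
      refine hspan ?_
      rw [hc]
      refine Submodule.sum_mem _ fun i _ => ?_
      by_cases hi : i ∈ longRoot n
      · rw [hcon i hi, zero_smul]
        exact zero_mem _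
      · exact Submodule.smul_of_tower_mem _ _ (Submodule.subset_span ⟨i, hi, rfl⟩)
    have hpos : 0 < μ ⬝ᵥ (1 : Fin n → ℝ) := by
      rw [hsum]
      refine Finset.sum_pos' (fun j _ => by split_ifs <;> positivity) ⟨i, Finset.mem_univ _, ?_⟩
      rw [if_pos hi]
      have : (0 : ℝ) < c i := by exact_mod_cast Nat.pos_of_ne_zero hci
      positivity
    have hx1 := hx.2 1
    set r := μ ⬝ᵥ (1 : Fin n → ℝ)
    rw [← fromBlocks_toBlocks x, cartanElement, Ring.lie_def, fromBlocks_multiply,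
      fromBlocks_multiply, fromBlocks_smul, sub_eq_add_neg, fromBlocks_neg, fromBlocks_add,
      fromBlocks_inj] at hx1
    obtain ⟨h11, -, h21, h22⟩ := hx1
    simp at h11 h21 h22
    rw [eq_comm, smul_eq_zero] at h11 h22
    refine ⟨?_, ?_, ?_⟩
    · exact h11.resolve_left hpos.ne'
    · have : (r + 2) • x.toBlocks₂₁ = 0 := by
        rw [add_smul, ← h21, two_smul]; abel
      exact (smul_eq_zero.1 this).resolve_left (by linarith)
    · exact h22.resolve_left hpos.ne'
  obtain ⟨h1, h2, h3⟩ := hU t.e_mem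
  conv_lhs => rw [← fromBlocks_toBlocks e, h1, h2, h3]

/-- The nontrivial block of the nilpositive element of a `Θ`-principal triple is a symmetric
involution, so the semisimple element is `diag(1, -1)`. -/
theorem IsThetaPrincipalTriple.exists_block {f h e : RMat n} (t : IsThetaPrincipalTriple f h e) :
    ∃ S : Matrix (Fin n) (Fin n) ℂ, Sᵀ = S ∧ S.det ≠ 0 ∧ complexify f = fromBlocks 0 0 S 0 ∧
      complexify h = gradingElement n := by
  set S := e.toBlocks₁₂ with hS
  have he : e = fromBlocks 0 S 0 0 := t.toBlocks_e
  have hdet : IsUnit S.det := by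
    rcases t.e_cone with hp | hp
    · exact hp.det_pos.ne'.isUnit
    · have := hp.det_pos.ne'.isUnit
      rw [det_neg] at this
      exact isUnit_of_mul_isUnit_right this
  have hsymm : Sᵀ = S := by
    rcases t.e_cone with hp | hp
    · simpa [Matrix.IsHermitian, conjTranspose_eq_transpose_of_trivial] using hp.isHermitian
    · simpa [Matrix.IsHermitian, conjTranspose_eq_transpose_of_trivial] using hp.isHermitian
  have hf : f = fromBlocks 0 0 S 0 := by
    rw [t.f_eq, he, fromBlocks_transpose, hsymm]; simp
  have hh : h = fromBlocks (S * S) 0 0 (-(S * S)) := by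
    rw [t.h_eq, hf, he, Ring.lie_def, fromBlocks_multiply, fromBlocks_multiply, sub_eq_add_neg,
      fromBlocks_neg, fromBlocks_add]
    simp
  have h3 := t.lie_h_e
  rw [hh, he, Ring.lie_def, fromBlocks_multiply, fromBlocks_multiply, sub_eq_add_neg,
    fromBlocks_neg, fromBlocks_add, fromBlocks_smul, fromBlocks_inj] at h3
  have h4 : S * S * S + S * (S * S) = (2 : ℝ) • S := by simpa using h3.2.1
  have h5 : S * S * S = 1 * S := by
    rw [← mul_assoc, ← two_smul ℝ (S * S * S)] at h4
    rw [one_mul]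
    exact smul_right_injective _ (two_ne_zero (α := ℝ)) h4
  have h6 : S * S = 1 := by
    have := congrArg (· * S⁻¹) h5
    simpa [mul_assoc, mul_nonsing_inv S hdet] using this
  refine ⟨S.map Complex.ofReal, ?_, ?_, ?_, ?_⟩
  · rw [← transpose_map, hsymm]
  · have : (S.map Complex.ofReal).det = ((S.det : ℝ) : ℂ) :=
      (RingHom.map_det Complex.ofRealHom S).symm
    rw [this]
    exact_mod_cast hdet.ne_zero
  · rw [complexify, hf, fromBlocks_map]
    simp
  · rw [complexify, hh, h6, fromBlocks_map, gradingElement, fromBlocks_inj]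
    have h1 : (1 : Matrix (Fin n) (Fin n) ℝ).map Complex.ofReal = 1 :=
      Matrix.map_one _ Complex.ofReal_zero Complex.ofReal_one
    refine ⟨h1, by simp, by simp, ?_⟩
    rw [← h1]
    exact Matrix.ext fun i j => Complex.ofReal_neg _

/-! ### The parabolic of the triple -/

theorem mem_gradedPiece_gradingElement {k : ℤ} {x : Mat n} :
    x ∈ gradedPiece (gradingElement n) k ↔ x ∈ spLie n ∧ (k : ℂ) • x.toBlocks₁₁ = 0 ∧
      ((k : ℂ) - 2) • x.toBlocks₁₂ = 0 ∧ ((k : ℂ) + 2) • x.toBlocks₂₁ = 0 ∧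
      (k : ℂ) • x.toBlocks₂₂ = 0 := by
  change _ ∧ _ ↔ _
  refine and_congr_right fun _ => ?_
  obtain ⟨A, B, C, D, rfl⟩ : ∃ A B C D, x = fromBlocks A B C D :=
    ⟨_, _, _, _, (fromBlocks_toBlocks x).symm⟩
  rw [gradingElement, Ring.lie_def, fromBlocks_multiply, fromBlocks_multiply, sub_eq_add_neg,
    fromBlocks_neg, fromBlocks_add, fromBlocks_smul, fromBlocks_inj]
  simp only [toBlocks_fromBlocks₁₁, toBlocks_fromBlocks₁₂, toBlocks_fromBlocks₂₁,
    toBlocks_fromBlocks₂₂, one_mul, mul_one, zero_mul, mul_zero, add_zero, zero_add,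
    neg_mul, mul_neg, neg_neg, add_neg_cancel, neg_add_cancel]
  refine and_congr eq_comm (and_congr ?_ (and_congr ?_ eq_comm))
  · rw [sub_smul, sub_eq_zero, two_smul, eq_comm]
  · rw [add_smul, two_smul, ← sub_eq_zero, ← neg_eq_zero]
    refine Eq.congr ?_ rfl
    abel

theorem fromBlocks_mem_spLie_diag {x : Mat n} (hx : x ∈ spLie n) :
    fromBlocks x.toBlocks₁₁ 0 0 x.toBlocks₂₂ ∈ spLie n := by
  rw [mem_spLie_iff_blocks] at hx ⊢
  simpa using hx.2.2

theorem fromBlocks_mem_spLie_upper {x : Mat n} (hx : x ∈ spLie n) :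
    fromBlocks 0 x.toBlocks₁₂ 0 0 ∈ spLie n := by
  rw [mem_spLie_iff_blocks] at hx ⊢
  simpa using hx.1

/-- The parabolic subalgebra consists of the block upper triangular matrices: `ad h` acts on the
diagonal blocks by `0`, on the upper right block by `2` and on the lower left block by `-2`. -/
theorem mem_parabolicLie_iff {x : Mat n} (hx : x ∈ spLie n) :
    x ∈ parabolicLie (gradingElement n) ↔ x.toBlocks₂₁ = 0 := by
  constructor
  · intro h
    let U : Submodule ℂ (Mat n) :=
      { carrier := {x | x.toBlocks₂₁ = 0}
        add_mem' := fun {x y} (hx : x.toBlocks₂₁ = 0) (hy : y.toBlocks₂₁ = 0) => by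
          change x.toBlocks₂₁ + y.toBlocks₂₁ = 0
          rw [hx, hy, add_zero]
        zero_mem' := rfl
        smul_mem' := fun c x (hx : x.toBlocks₂₁ = 0) => by
          change c • x.toBlocks₂₁ = 0
          rw [hx, smul_zero] }
    refine (iSup₂_le fun k hk y hy => ?_ : parabolicLie (gradingElement n) ≤ U) h
    have hk2 : (k : ℂ) + 2 ≠ 0 := by exact_mod_cast (by omega : k + 2 ≠ 0)
    exact (smul_eq_zero.1 (mem_gradedPiece_gradingElement.1 hy).2.2.2.1).resolve_left hk2
  · intro h
    have hx' : x = fromBlocks x.toBlocks₁₁ 0 0 x.toBlocks₂₂ + fromBlocks 0 x.toBlocks₁₂ 0 0 := by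
      rw [fromBlocks_add, add_zero, add_zero, add_zero, zero_add]
      conv_lhs => rw [← fromBlocks_toBlocks x, h]
    rw [hx']
    refine Submodule.add_mem _ ?_ ?_
    · refine Submodule.mem_iSup_of_mem 0 (Submodule.mem_iSup_of_mem le_rfl ?_)
      exact mem_gradedPiece_gradingElement.2 ⟨fromBlocks_mem_spLie_diag hx, by simp⟩
    · refine Submodule.mem_iSup_of_mem 2 (Submodule.mem_iSup_of_mem (by norm_num) ?_)
      exact mem_gradedPiece_gradingElement.2 ⟨fromBlocks_mem_spLie_upper hx, by simp⟩

/-- The nilradical in terms of the subspace `ℂⁿ ⊕ 0` alone. -/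
theorem mem_nilpotentLie_iff {x : Mat n} :
    x ∈ nilpotentLie (gradingElement n) ↔ x ∈ spLie n ∧
      (∀ v, x *ᵥ v ∈ stdLagrangian n) ∧ ∀ v ∈ stdLagrangian n, x *ᵥ v = 0 := by
  constructor
  · intro h
    let U : Submodule ℂ (Mat n) :=
      { carrier := {x | x ∈ spLie n ∧
          (∀ v, x *ᵥ v ∈ stdLagrangian n) ∧ ∀ v ∈ stdLagrangian n, x *ᵥ v = 0}
        add_mem' := by
          rintro x y ⟨h1, h2, h3⟩ ⟨k1, k2, k3⟩
          refine ⟨add_mem h1 k1, fun v => ?_, fun v hv => ?_⟩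
          · rw [add_mulVec]; exact add_mem (h2 v) (k2 v)
          · rw [add_mulVec, h3 v hv, k3 v hv, add_zero]
        zero_mem' := ⟨zero_mem _, fun v => by simp, fun v _ => by simp⟩
        smul_mem' := by
          rintro c x ⟨h1, h2, h3⟩
          refine ⟨(spLie n).smul_mem c h1, fun v => ?_, fun v hv => ?_⟩
          · rw [smul_mulVec]; exact Submodule.smul_mem _ _ (h2 v)
          · rw [smul_mulVec, h3 v hv, smul_zero] }
    refine (iSup₂_le fun k hk y hy => ?_ : nilpotentLie (gradingElement n) ≤ U) h
    obtain ⟨hsp, h11, -, h21, h22⟩ := mem_gradedPiece_gradingElement.1 hy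
    have hk0 : (k : ℂ) ≠ 0 := by exact_mod_cast hk.ne'
    have hk2 : (k : ℂ) + 2 ≠ 0 := by exact_mod_cast (by omega : k + 2 ≠ 0)
    have h11 := (smul_eq_zero.1 h11).resolve_left hk0
    have h21 := (smul_eq_zero.1 h21).resolve_left hk2
    have h22 := (smul_eq_zero.1 h22).resolve_left hk0
    have hy' : y = fromBlocks 0 y.toBlocks₁₂ 0 0 := by
      conv_lhs => rw [← fromBlocks_toBlocks y, h11, h21, h22]
    refine ⟨hsp, fun v => ?_, fun v hv => ?_⟩
    · rw [mem_stdLagrangian, hy']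
      intro i
      simp [fromBlocks_mulVec]
    · rw [mem_stdLagrangian] at hv
      rw [hy', fromBlocks_mulVec]
      have : v ∘ Sum.inr = 0 := funext hv
      rw [this]
      ext (i | i) <;> simp
  · rintro ⟨hsp, h1, h2⟩
    have h21 : x.toBlocks₂₁ = 0 := toBlocks₂₁_eq_zero_iff.2 fun v _ => h1 v
    have h11 : x.toBlocks₁₁ = 0 := by
      ext i j
      have := congrFun (h2 (Pi.single (Sum.inl j) 1) (by simp [mem_stdLagrangian])) (Sum.inl i)
      simpa [toBlocks₁₁] using this
    have h22 : x.toBlocks₂₂ = 0 := by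
      rw [(mem_spLie_iff_blocks.1 hsp).2.2, h11]; simp
    have hx' : x = fromBlocks 0 x.toBlocks₁₂ 0 0 := by
      conv_lhs => rw [← fromBlocks_toBlocks x, h11, h21, h22]
    refine Submodule.mem_iSup_of_mem 2 (Submodule.mem_iSup_of_mem (by norm_num) ?_)
    exact mem_gradedPiece_gradingElement.2 ⟨hsp, by simp [h11, h21, h22]⟩

theorem Ad_mem_spLie (g : SpC n) {x : Mat n} (hx : x ∈ spLie n) : Ad g x ∈ spLie n := by
  rw [mem_spLie_iff_form] at hx ⊢
  intro v w
  simp only [Ad, ← mulVec_mulVec]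
  set v' := ((g⁻¹ : SpC n) : Mat n) *ᵥ v with hv'
  set w' := ((g⁻¹ : SpC n) : Mat n) *ᵥ w with hw'
  have hv : v = (g : Mat n) *ᵥ v' := (symplectic_mulVec_inv_mulVec g v).symm
  have hw : w = (g : Mat n) *ᵥ w' := (symplectic_mulVec_inv_mulVec g w).symm
  conv_lhs => rw [hv, hw]
  rw [symplectic_form, symplectic_form]
  exact hx v' w'

theorem Ad_inv_Ad (g : SpC n) (x : Mat n) : Ad g⁻¹ (Ad g x) = x := by
  rw [← Ad_mul, inv_mul_cancel, Ad_one]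

theorem Ad_Ad_inv (g : SpC n) (x : Mat n) : Ad g (Ad g⁻¹ x) = x := by
  rw [← Ad_mul, mul_inv_cancel, Ad_one]

/-- The parabolic subgroup is the stabilizer of `ℂⁿ ⊕ 0`. The nilradical `𝔲` consists of the `x`
with image in `ℂⁿ ⊕ 0` and kernel containing it, and `ℂⁿ ⊕ 0` is the common kernel of `𝔲`. -/
theorem mem_parabolic_iff {g : SpC n} :
    g ∈ parabolic (gradingElement n) ↔
      ∀ v, (g : Mat n) *ᵥ v ∈ stdLagrangian n ↔ v ∈ stdLagrangian n := by
  -- the common kernel of the nilradical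
  have hker : ∀ v : Std n, v ∈ stdLagrangian n ↔
      ∀ x ∈ nilpotentLie (gradingElement n), x *ᵥ v = 0 := by
    intro v
    refine ⟨fun hv x hx => (mem_nilpotentLie_iff.1 hx).2.2 v hv, fun h => ?_⟩
    have := h (fromBlocks 0 1 0 0) (mem_nilpotentLie_iff.2 ⟨?_, fun v => ?_, fun v hv => ?_⟩)
    · rw [mem_stdLagrangian]
      intro i
      have := congrFun this (Sum.inl i)
      simpa [fromBlocks_mulVec] using this
    · rw [mem_spLie_iff_blocks]; simp
    · rw [mem_stdLagrangian]
      intro i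
      simp [fromBlocks_mulVec]
    · have : v ∘ Sum.inr = 0 := funext (mem_stdLagrangian.1 hv)
      rw [fromBlocks_mulVec, this]
      ext (i | i) <;> simp
  constructor
  · intro hg
    have hg' : ∀ x, Ad g x ∈ nilpotentLie (gradingElement n) ↔
      x ∈ nilpotentLie (gradingElement n) := hg
    intro v
    rw [hker, hker]
    constructor
    · intro h x hx
      have := h _ ((hg' x).2 hx)
      rw [Ad, mulVec_mulVec, mul_assoc, symplectic_inv_mul, mul_one, ← mulVec_mulVec] at this
      rw [← symplectic_inv_mulVec_mulVec g (x *ᵥ v), this, mulVec_zero]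
    · intro h x hx
      have := h (Ad g⁻¹ x) ((hg' _).1 (by rwa [Ad_Ad_inv]))
      rw [Ad, inv_inv, ← mulVec_mulVec, ← mulVec_mulVec] at this
      rw [← symplectic_mulVec_inv_mulVec g (x *ᵥ _), this, mulVec_zero]
  · intro hg
    have key : ∀ g : SpC n, (∀ v, (g : Mat n) *ᵥ v ∈ stdLagrangian n ↔ v ∈ stdLagrangian n) →
        ∀ x ∈ nilpotentLie (gradingElement n), Ad g x ∈ nilpotentLie (gradingElement n) := by
      intro g hg x hx
      rw [mem_nilpotentLie_iff] at hx ⊢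
      refine ⟨Ad_mem_spLie g hx.1, fun v => ?_, fun v hv => ?_⟩
      · rw [Ad, ← mulVec_mulVec, ← mulVec_mulVec, hg]
        exact hx.2.1 _
      · rw [Ad, ← mulVec_mulVec, ← mulVec_mulVec, hx.2.2, mulVec_zero]
        rwa [← hg, symplectic_mulVec_inv_mulVec]
    intro x
    refine ⟨fun h => ?_, key g hg x⟩
    rw [← Ad_inv_Ad g x]
    refine key g⁻¹ (fun v => ?_) _ h
    rw [← hg, symplectic_mulVec_inv_mulVec]

/-- Two invertible complex symmetric matrices are congruent. -/
theorem exists_congruent {ι : Type*} [Fintype ι] [DecidableEq ι] {C S : Matrix ι ι ℂ}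
    (hC : Cᵀ = C) (hC0 : C.det ≠ 0) (hS : Sᵀ = S) (hS0 : S.det ≠ 0) :
    ∃ M : Matrix ι ι ℂ, M.det ≠ 0 ∧ C = M * S * Mᵀ := by
  have hass : ∀ D : Matrix ι ι ℂ, Dᵀ = D →
      QuadraticMap.associated (R := ℂ) D.toQuadraticForm' = Matrix.toLinearMap₂' ℂ D := by
    intro D hD
    refine QuadraticMap.associated_left_inverse _ (fun x y => ?_)
    rw [Matrix.toLinearMap₂'_apply', Matrix.toLinearMap₂'_apply', dotProduct_comm,
      ← vecMul_transpose, hD, dotProduct_mulVec]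
  have hsep : ∀ D : Matrix ι ι ℂ, Dᵀ = D → D.det ≠ 0 →
      (QuadraticMap.associated (R := ℂ) D.toQuadraticForm').SeparatingLeft := by
    intro D hD hD0
    rw [hass D hD, Matrix.separatingLeft_toLinearMap₂'_iff]
    exact Matrix.separatingLeft_iff_det_ne_zero.2 hD0
  obtain ⟨e⟩ := QuadraticForm.equivalent_of_isAlgClosed C.toQuadraticForm' S.toQuadraticForm'
    (hsep C hC hC0) (hsep S hS hS0)
  have hcomp : C.toQuadraticForm' = S.toQuadraticForm'.comp e.toLinearEquiv.toLinearMap := by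
    ext v
    exact (e.map_app v).symm
  have h := congrArg QuadraticForm.toMatrix' hcomp
  rw [QuadraticForm.toMatrix'_comp, QuadraticForm.toMatrix', QuadraticForm.toMatrix', hass C hC,
    hass S hS, LinearMap.toMatrix'_toLinearMap₂', LinearMap.toMatrix'_toLinearMap₂'] at h
  refine ⟨(LinearMap.toMatrix' e.toLinearEquiv.toLinearMap)ᵀ, fun h0 => hC0 ?_, ?_⟩
  · rw [h, det_mul, det_mul, h0, zero_mul, zero_mul]
  · rw [transpose_transpose]; exact h

/-- The class of `x` modulo `𝔭` lies in the orbit `P_Θ · f` if and only if the lower left block of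
`x` is invertible: the Levi factor `GL_n` acts on this block by congruence, and the invertible
complex symmetric matrices form one congruence class. -/
theorem exists_mem_parabolic_iff {S : Matrix (Fin n) (Fin n) ℂ} (hS : Sᵀ = S) (hS0 : S.det ≠ 0)
    {x : Mat n} (hx : x ∈ spLie n) :
    (∃ g ∈ parabolic (gradingElement n),
      x - Ad g (fromBlocks 0 0 S 0) ∈ parabolicLie (gradingElement n)) ↔
      x.toBlocks₂₁.det ≠ 0 := by
  have hf : fromBlocks 0 0 S 0 ∈ spLie n := by
    rw [mem_spLie_iff_blocks]; simpa using hS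
  have hsub : ∀ g : SpC n, x - Ad g (fromBlocks 0 0 S 0) ∈ parabolicLie (gradingElement n) ↔
      x.toBlocks₂₁ = (Ad g (fromBlocks 0 0 S 0)).toBlocks₂₁ := by
    intro g
    rw [mem_parabolicLie_iff (sub_mem hx (Ad_mem_spLie g hf)), ← sub_eq_zero (a := x.toBlocks₂₁)]
    rfl
  constructor
  · rintro ⟨g, hg, h⟩
    rw [(hsub g).1 h, det_toBlocks₂₁_ne_zero_iff]
    intro v hv hxv
    rw [mem_parabolic_iff] at hg
    rw [Ad, ← mulVec_mulVec, ← mulVec_mulVec, hg] at hxv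
    have hf0 : (fromBlocks 0 0 S 0 : Mat n).toBlocks₂₁.det ≠ 0 := by simpa using hS0
    have := det_toBlocks₂₁_ne_zero_iff.1 hf0 _
      (by rwa [← hg, symplectic_mulVec_inv_mulVec]) hxv
    rw [← symplectic_mulVec_inv_mulVec g v, this, mulVec_zero]
  · intro h
    obtain ⟨M, hM, hxM⟩ := exists_congruent (mem_spLie_iff_blocks.1 hx).2.1 h hS hS0
    have hMu : IsUnit M.det := hM.isUnit
    have hMt : IsUnit Mᵀ.det := by rwa [det_transpose]
    -- the element of the Levi factor given by `M`
    have hA : fromBlocks (Mᵀ)⁻¹ 0 0 M ∈ symplecticGroup (Fin n) ℂ := by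
      rw [SymplecticGroup.mem_iff, J, fromBlocks_transpose, fromBlocks_multiply,
        fromBlocks_multiply]
      simp [transpose_nonsing_inv, mul_nonsing_inv _ hMu, nonsing_inv_mul _ hMt]
    have hAinv : (((⟨_, hA⟩ : SpC n)⁻¹ : SpC n) : Mat n) = fromBlocks Mᵀ 0 0 M⁻¹ := by
      have h1 : fromBlocks (Mᵀ)⁻¹ 0 0 M * fromBlocks Mᵀ 0 0 M⁻¹ = (1 : Mat n) := by
        rw [fromBlocks_multiply]
        simp [mul_nonsing_inv _ hMu, nonsing_inv_mul _ hMt]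
      calc _ = (((⟨_, hA⟩ : SpC n)⁻¹ : SpC n) : Mat n) *
            (fromBlocks (Mᵀ)⁻¹ 0 0 M * fromBlocks Mᵀ 0 0 M⁻¹) := by rw [h1, mul_one]
        _ = _ := by
          rw [← mul_assoc]
          have := symplectic_inv_mul (⟨_, hA⟩ : SpC n)
          simp only at this
          rw [this, one_mul]
    refine ⟨⟨_, hA⟩, ?_, ?_⟩
    · rw [mem_parabolic_iff]
      intro v
      simp only [mem_stdLagrangian]
      have : ∀ i, (fromBlocks (Mᵀ)⁻¹ 0 0 M *ᵥ v) (Sum.inr i) = (M *ᵥ (v ∘ Sum.inr)) i := by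
        intro i
        simp [fromBlocks_mulVec]
      simp only [this]
      constructor
      · intro h0
        have h1 : M *ᵥ (v ∘ Sum.inr) = 0 := funext h0
        have h2 := congrArg (M⁻¹ *ᵥ ·) h1
        simp only [mulVec_mulVec, nonsing_inv_mul _ hMu, one_mulVec, mulVec_zero] at h2
        exact congrFun h2
      · intro h0 i
        rw [show v ∘ Sum.inr = 0 from funext h0, mulVec_zero]; rfl
    · rw [hsub, Ad, hAinv, fromBlocks_multiply, fromBlocks_multiply, hxM]
      simp

end LinearAlgebra

/-! ### Holomorphic maps to the symplectic group -/

section Group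

variable {X : Type u} [TopologicalSpace X] [ChartedSpace ℂ X] {x : X} {n : ℕ} {g k : X → SpC n}

namespace HolGroupAt

theorem const (a : SpC n) : HolGroupAt (fun _ : X => a) x := fun _ _ => HolAt.const _

theorem congr (h : HolGroupAt g x) (e : ∀ᶠ y in 𝓝 x, k y = g y) : HolGroupAt k x := fun i j =>
  (h i j).congr (e.mono fun y hy => by rw [hy])

theorem mul (h : HolGroupAt g x) (h' : HolGroupAt k x) : HolGroupAt (fun y => g y * k y) x := by
  intro i j
  simp only [Submonoid.coe_mul, Matrix.mul_apply]
  exact HolAt.sum fun l _ => (h i l).mul (h' l j)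

theorem inv (h : HolGroupAt g x) : HolGroupAt (fun y => (g y)⁻¹) x := by
  intro i j
  simp only [SymplecticGroup.coe_inv, Matrix.mul_apply, Matrix.neg_apply, Matrix.transpose_apply,
    Matrix.neg_mul]
  exact HolAt.sum fun l _ => (HolAt.sum fun m _ => (HolAt.const _).mul (h _ _)).neg.mul
    (HolAt.const _)

theorem eventually [IsManifold 𝓘(ℂ) ω X] (h : HolGroupAt g x) : ∀ᶠ y in 𝓝 x, HolGroupAt g y := by
  simp only [HolGroupAt, Filter.eventually_all]
  exact fun i j => (h i j).eventually

theorem continuousAt (h : HolGroupAt g x) : ContinuousAt g x := by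
  refine Topology.IsInducing.subtypeVal.continuousAt_iff.2 ?_
  exact continuousAt_pi.2 fun i => continuousAt_pi.2 fun j => (h i j).continuousAt

theorem mulVec (h : HolGroupAt g x) {c : X → Std n} (hc : ∀ i, HolAt (fun y => c y i) x) (i) :
    HolAt (fun y => ((g y : Mat n) *ᵥ c y) i) x := by
  simp only [Matrix.mulVec, dotProduct]
  exact HolAt.sum fun l _ => (h i l).mul (hc l)

end HolGroupAt

/-- A symplectic matrix with holomorphic columns is holomorphic. -/
theorem holGroupAt_iff_mulVec :
    HolGroupAt g x ↔ ∀ (v : Std n) (i), HolAt (fun y => ((g y : Mat n) *ᵥ v) i) x := by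
  refine ⟨fun h v => h.mulVec fun i => HolAt.const _, fun h i j => ?_⟩
  simpa using h (Pi.single j 1) i

theorem dGroup_eq_zero_of_eventually_const {a : SpC n} (h : ∀ᶠ y in 𝓝 x, g y = a)
    (ξ : TangentSpace 𝓘(ℂ) x) : dGroup g x ξ = 0 := by
  ext i j
  have : (fun y => (g y : Mat n) i j) =ᶠ[𝓝 x] fun _ => (a : Mat n) i j :=
    h.mono fun y hy => by simp only [hy]
  simp only [dGroup, Matrix.of_apply, mvfderiv, this.mfderiv_eq]
  rw [mfderiv_const]
  rfl

theorem mvfderiv_sum_mul {ι : Type*} (t : Finset ι) {a b : ι → X → ℂ}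
    (ha : ∀ i, MDifferentiableAt 𝓘(ℂ) 𝓘(ℂ) (a i) x)
    (hb : ∀ i, MDifferentiableAt 𝓘(ℂ) 𝓘(ℂ) (b i) x) (ξ : TangentSpace 𝓘(ℂ) x) :
    MDifferentiableAt 𝓘(ℂ) 𝓘(ℂ) (fun y => ∑ i ∈ t, a i y * b i y) x ∧
    mvfderiv 𝓘(ℂ) (fun y => ∑ i ∈ t, a i y * b i y) x ξ =
      ∑ i ∈ t, (mvfderiv 𝓘(ℂ) (a i) x ξ * b i x + a i x * mvfderiv 𝓘(ℂ) (b i) x ξ) := by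
  classical
  induction t using Finset.induction_on with
  | empty =>
    simp only [Finset.sum_empty]
    exact ⟨mdifferentiableAt_const, by rw [mvfderiv_const]; rfl⟩
  | insert i t hi ih =>
    simp only [Finset.sum_insert hi]
    have hm : MDifferentiableAt 𝓘(ℂ) 𝓘(ℂ) (fun y => a i y * b i y) x := (ha i).mul (hb i)
    refine ⟨hm.add ih.1, ?_⟩
    rw [mvfderiv_fun_add hm ih.1, _root_.add_apply, ih.2,
      mvfderiv_fun_mul (ha i) (hb i)]
    simp only [_root_.add_apply, _root_.smul_apply, smul_eq_mul]
    simp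
    ring

/-- The Leibniz rule `d(g c) = dg · c + g · dc`. -/
theorem dGroup_mulVec (h : HolGroupAt g x) (ξ : TangentSpace 𝓘(ℂ) x) {c : X → Std n}
    (hc : ∀ i, MDifferentiableAt 𝓘(ℂ) 𝓘(ℂ) (fun y => c y i) x) (i) :
    mvfderiv 𝓘(ℂ) (fun y => ((g y : Mat n) *ᵥ c y) i) x ξ =
      (dGroup g x ξ *ᵥ c x) i + ((g x : Mat n) *ᵥ fun j => mvfderiv 𝓘(ℂ) (fun y => c y j) x ξ) i := by
  simp only [Matrix.mulVec, dotProduct]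
  rw [(mvfderiv_sum_mul Finset.univ (fun j => (h i j).mdifferentiableAt) hc ξ).2,
    Finset.sum_add_distrib]
  rfl

end Group

/-! ### Holomorphic sections of principal bundles -/

section Principal

variable {X : Type u} [TopologicalSpace X] [ChartedSpace ℂ X] {x : X} {n : ℕ}
  {P : X → Type v} [TopologicalSpace (TotalSpace (SpC n) P)]
  [∀ x, TopologicalSpace (P x)] [FiberBundle (SpC n) P] [∀ x, MulAction (SpC n)ᵐᵒᵖ (P x)]
  [IsHolPrincipalBundle n P]

theorem trivializationAt_smul (x : X) {y : X}
    (hy : y ∈ (trivializationAt (SpC n) P x).baseSet) (p : P y) (g : SpC n) :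
    (trivializationAt (SpC n) P x ⟨y, p <• g⟩).2 = (trivializationAt (SpC n) P x ⟨y, p⟩).2 * g :=
  IsHolPrincipalBundle.equivariant _ (trivialization_mem_atlas _ _ _) _ hy p g

theorem trivialization_injective (τ : Trivialization (SpC n) (π (SpC n) P)) {y : X}
    (hy : y ∈ τ.baseSet) {p q : P y} (h : (τ ⟨y, p⟩).2 = (τ ⟨y, q⟩).2) : p = q := by
  have h1 : (⟨y, p⟩ : TotalSpace (SpC n) P) ∈ τ.source := τ.mem_source.2 hy
  have h2 : (⟨y, q⟩ : TotalSpace (SpC n) P) ∈ τ.source := τ.mem_source.2 hy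
  have := τ.injOn h1 h2 (Prod.ext ((τ.coe_fst h1).trans (τ.coe_fst h2).symm) h)
  exact eq_of_heq (TotalSpace.mk.inj this).2

/-- The element `g` of the structure group with `q = p g`, for `p`, `q` in the same fibre. -/
noncomputable def fibreDiv (p q : P x) : SpC n :=
  (trivializationAt (SpC n) P x ⟨x, p⟩).2⁻¹ * (trivializationAt (SpC n) P x ⟨x, q⟩).2

theorem smul_fibreDiv (p q : P x) : p <• (fibreDiv p q : SpC n) = q := by
  have hx := mem_baseSet_trivializationAt (SpC n) P x
  refine trivialization_injective (n := n) _ hx ?_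
  rw [trivializationAt_smul x hx, fibreDiv, mul_inv_cancel_left]

theorem fibreDiv_eq_of_trivialization {τ : Trivialization (SpC n) (π (SpC n) P)}
    (hτ : τ ∈ FiberBundle.trivializationAtlas (SpC n) P) (hx : x ∈ τ.baseSet) (p q : P x) :
    fibreDiv p q = (τ ⟨x, p⟩).2⁻¹ * (τ ⟨x, q⟩).2 := by
  have h := IsHolPrincipalBundle.equivariant τ hτ x hx p (fibreDiv p q)
  rw [smul_fibreDiv] at h
  rw [h, inv_mul_cancel_left]

theorem fibreDiv_smul_right (p q : P x) (g : SpC n) : fibreDiv p (q <• g) = fibreDiv p q * g := by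
  rw [fibreDiv, trivializationAt_smul x (mem_baseSet_trivializationAt (SpC n) P x), fibreDiv,
    mul_assoc]

theorem fibreDiv_self (p : P x) : (fibreDiv p p : SpC n) = 1 := by
  rw [fibreDiv, inv_mul_cancel]

/-- Holomorphy of a section can be tested in any trivialization of the atlas. -/
theorem holPSectionAt_iff {s : ∀ y, P y} {τ : Trivialization (SpC n) (π (SpC n) P)}
    (hτ : τ ∈ FiberBundle.trivializationAtlas (SpC n) P) (hx : x ∈ τ.baseSet) :
    HolPSectionAt n s x ↔ HolGroupAt (fun y => (τ ⟨y, s y⟩).2) x := by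
  have key : ∀ τ ∈ FiberBundle.trivializationAtlas (SpC n) P,
      ∀ τ' ∈ FiberBundle.trivializationAtlas (SpC n) P, x ∈ τ.baseSet → x ∈ τ'.baseSet →
      HolGroupAt (fun y => (τ ⟨y, s y⟩).2) x → HolGroupAt (fun y => (τ' ⟨y, s y⟩).2) x := by
    intro τ hτ τ' hτ' hx hx' h
    refine ((IsHolPrincipalBundle.holomorphic τ hτ τ' hτ' x ⟨hx, hx'⟩).mul h).congr ?_
    filter_upwards [τ.open_baseSet.mem_nhds hx, τ'.open_baseSet.mem_nhds hx'] with y hy hy'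
    obtain ⟨p, hp⟩ : ∃ p : P y, τ.toOpenPartialHomeomorph.symm (y, 1) = ⟨y, p⟩ := by
      have h := τ.proj_symm_apply' (b := y) (x := (1 : SpC n)) hy
      generalize τ.toOpenPartialHomeomorph.symm (y, 1) = z at h
      obtain ⟨z, p⟩ := z
      subst h
      exact ⟨p, rfl⟩
    have hp1 : (τ ⟨y, p⟩).2 = 1 := by
      rw [← hp, τ.apply_symm_apply (τ.mem_target.2 hy)]
    rw [hp]
    have h2 : s y = p <• (τ ⟨y, s y⟩).2 := by
      refine trivialization_injective (n := n) τ hy ?_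
      rw [IsHolPrincipalBundle.equivariant τ hτ y hy, hp1, one_mul]
    conv_lhs => rw [h2]
    rw [IsHolPrincipalBundle.equivariant τ' hτ' y hy']
  have hx0 := mem_baseSet_trivializationAt (SpC n) P x
  have h0 := trivialization_mem_atlas (SpC n) P x
  exact ⟨key _ h0 _ hτ hx0 hx, key _ hτ _ h0 hx hx0⟩

variable {s t : ∀ y, P y}

theorem HolPSectionAt.congr (h : HolPSectionAt n s x) (e : ∀ᶠ y in 𝓝 x, t y = s y) :
    HolPSectionAt n t x :=
  HolGroupAt.congr h (e.mono fun y hy => by rw [hy])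

theorem HolPSectionAt.eventually [IsManifold 𝓘(ℂ) ω X] (h : HolPSectionAt n s x) :
    ∀ᶠ y in 𝓝 x, HolPSectionAt n s y := by
  filter_upwards [HolGroupAt.eventually h, (trivializationAt (SpC n) P x).open_baseSet.mem_nhds
    (mem_baseSet_trivializationAt (SpC n) P x)] with y hy hy'
  exact (holPSectionAt_iff (trivialization_mem_atlas (SpC n) P x) hy').2 hy

theorem HolPSectionAt.fibreDiv (hs : HolPSectionAt n s x) (ht : HolPSectionAt n t x) :
    HolGroupAt (fun y => (fibreDiv (s y) (t y) : SpC n)) x := by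
  refine HolGroupAt.congr (HolGroupAt.mul (HolGroupAt.inv hs) ht) ?_
  filter_upwards [(trivializationAt (SpC n) P x).open_baseSet.mem_nhds
    (mem_baseSet_trivializationAt (SpC n) P x)] with y hy
  exact fibreDiv_eq_of_trivialization (trivialization_mem_atlas (SpC n) P x) hy _ _

theorem HolPSectionAt.smul (hs : HolPSectionAt n s x) {g : X → SpC n} (hg : HolGroupAt g x) :
    HolPSectionAt n (fun y => s y <• g y) x := by
  refine HolGroupAt.congr (HolGroupAt.mul hs hg) ?_
  filter_upwards [(trivializationAt (SpC n) P x).open_baseSet.mem_nhds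
    (mem_baseSet_trivializationAt (SpC n) P x)] with y hy
  exact trivializationAt_smul x hy _ _

theorem HolPSectionAt.of_fibreDiv (hs : HolPSectionAt n s x)
    (h : HolGroupAt (fun y => (Opers.fibreDiv (s y) (t y) : SpC n)) x) : HolPSectionAt n t x :=
  (hs.smul h).congr (Filter.Eventually.of_forall fun _ => (smul_fibreDiv _ _).symm)

/-- The transformation rule of a connection, for two arbitrary holomorphic sections. -/
theorem PrincipalConnection.pullback_eq [IsManifold 𝓘(ℂ) ω X] (A : PrincipalConnection n P)
    (hs : HolPSectionAt n s x) (ht : HolPSectionAt n t x) (ξ : TangentSpace 𝓘(ℂ) x) :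
    A.pullback t x ξ = Ad (fibreDiv (s x) (t x))⁻¹ (A.pullback s x ξ) +
      (((fibreDiv (s x) (t x))⁻¹ : SpC n) : Mat n) * dGroup (fun y => fibreDiv (s y) (t y)) x ξ := by
  have h := A.gauge s x hs _ (hs.fibreDiv ht) ξ
  simpa only [smul_fibreDiv] using h

end Principal

/-! ### Holomorphic sections of vector bundles -/

section Vector

variable {X : Type u} [TopologicalSpace X] [ChartedSpace ℂ X] {x : X} {n : ℕ}
  {E : X → Type v} [∀ x, AddCommGroup (E x)] [∀ x, Module ℂ (E x)]
  [TopologicalSpace (TotalSpace (Std n) E)] [∀ x, TopologicalSpace (E x)] [FiberBundle (Std n) E]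

namespace HolSectionAt

variable {s t : ∀ y, E y}

theorem congr (h : HolSectionAt n s x) (e : ∀ᶠ y in 𝓝 x, t y = s y) : HolSectionAt n t x :=
  ContMDiffAt.congr_of_eventuallyEq h (e.mono fun y hy => by simp only [hy])

variable [VectorBundle ℂ (Std n) E]

theorem add (hs : HolSectionAt n s x) (ht : HolSectionAt n t x) :
    HolSectionAt n (fun y => s y + t y) x :=
  ContMDiffAt.add_section hs ht

theorem smul {φ : X → ℂ} (hφ : HolAt φ x) (hs : HolSectionAt n s x) :
    HolSectionAt n (fun y => φ y • s y) x :=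
  ContMDiffAt.smul_section hφ hs

theorem sum {ι : Type*} {a : Finset ι} {s : ι → ∀ y, E y} (hs : ∀ i, HolSectionAt n (s i) x) :
    HolSectionAt n (fun y => ∑ i ∈ a, s i y) x :=
  ContMDiffAt.sum_section fun i _ => hs i

theorem mdifferentiableAt (hs : HolSectionAt n s x) :
    MDifferentiableAt 𝓘(ℂ) (𝓘(ℂ).prod 𝓘(ℂ, Std n)) (fun y => TotalSpace.mk' (Std n) y (s y)) x :=
  ContMDiffAt.mdifferentiableAt hs (by simp)

theorem eventually [IsManifold 𝓘(ℂ) ω X] [ContMDiffVectorBundle ω (Std n) E 𝓘(ℂ)]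
    (hs : HolSectionAt n s x) : ∀ᶠ y in 𝓝 x, HolSectionAt n s y :=
  (contMDiffAt_iff_contMDiffAt_nhds (by simp)).1 hs

end HolSectionAt

theorem exists_holSectionAt [VectorBundle ℂ (Std n) E] (v : E x) :
    ∃ s : ∀ y, E y, HolSectionAt n s x ∧ s x = v :=
  ⟨FiberBundle.extend (Std n) v, FiberBundle.contMDiffAt_extend 𝓘(ℂ) (Std n) v,
    FiberBundle.extend_apply_self (Std n) v⟩

theorem linearEquiv_apply_eq_sum {W : Type*} [AddCommGroup W] [Module ℂ W] (φ : Std n ≃ₗ[ℂ] W)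
    (w : W) : w = ∑ a, φ.symm w a • φ (Pi.single a 1) := by
  conv_lhs => rw [← φ.apply_symm_apply w, ← Finset.univ_sum_single (φ.symm w), map_sum]
  refine Finset.sum_congr rfl fun a _ => ?_
  rw [← map_smul, ← Pi.single_smul, smul_eq_mul, mul_one]

variable [VectorBundle ℂ (Std n) E] {B : ∀ x, E x →ₗ[ℂ] E x →ₗ[ℂ] ℂ}
  {φ : ∀ y, Std n ≃ₗ[ℂ] E y}

/-- In a holomorphic symplectic frame, a section is holomorphic if and only if its coordinates
are: the coordinates are values of the symplectic form. -/
theorem holSectionAt_iff_coord (hB : IsSymplecticForm n B)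
    (hφ : ∀ v, HolSectionAt n (fun y => φ y v) x)
    (hφB : ∀ y v w, B y (φ y v) (φ y w) = v ⬝ᵥ (J (Fin n) ℂ *ᵥ w)) {s : ∀ y, E y} :
    HolSectionAt n s x ↔ ∀ a, HolAt (fun y => (φ y).symm (s y) a) x := by
  constructor
  · intro hs a
    have key : ∀ w : Std n,
        HolAt (fun y => w ⬝ᵥ (J (Fin n) ℂ *ᵥ ((φ y).symm (s y)))) x := by
      intro w
      refine (hB.holomorphic _ _ x (hφ w) hs).congr (Filter.Eventually.of_forall fun y => ?_)
      rw [← hφB y, LinearEquiv.apply_symm_apply]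
    simp only [dotProduct_J_mulVec] at key
    rcases a with i | i
    · simpa [Pi.single_apply] using key (Pi.single (Sum.inr i) 1)
    · simpa [Pi.single_apply] using (key (Pi.single (Sum.inl i) 1)).neg
  · intro h
    refine (HolSectionAt.sum (a := Finset.univ) fun a =>
      HolSectionAt.smul (h a) (hφ (Pi.single a 1))).congr (Filter.Eventually.of_forall fun y => ?_)
    exact linearEquiv_apply_eq_sum (φ y) (s y)

variable [∀ x, IsTopologicalAddGroup (E x)] [∀ x, ContinuousSMul ℂ (E x)]

theorem covariantDerivative_sum (D : CovariantDerivative 𝓘(ℂ) (Std n) E) {ι : Type*}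
    (a : Finset ι) {s : ι → ∀ y, E y}
    (hs : ∀ i, MDifferentiableAt 𝓘(ℂ) (𝓘(ℂ).prod 𝓘(ℂ, Std n))
      (fun y => TotalSpace.mk' (Std n) y (s i y)) x) :
    D (fun y => ∑ i ∈ a, s i y) x = ∑ i ∈ a, D (s i) x := by
  classical
  induction a using Finset.induction_on with
  | empty =>
    simp only [Finset.sum_empty]
    exact D.isCovariantDerivativeOnUniv.zero
  | insert i a hi ih =>
    simp only [Finset.sum_insert hi]
    rw [← ih]
    exact D.isCovariantDerivativeOnUniv.add (hs i) (MDifferentiableAt.sum_section fun j _ => hs j)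

/-- A connection in a frame: `D(∑ cₐ φₐ) = ∑ cₐ Dφₐ + ∑ dcₐ φₐ`. -/
theorem covariantDerivative_frame (D : CovariantDerivative 𝓘(ℂ) (Std n) E)
    (hφ : ∀ v, HolSectionAt n (fun y => φ y v) x) {s : ∀ y, E y}
    (hs : ∀ a, MDifferentiableAt 𝓘(ℂ) 𝓘(ℂ) (fun y => (φ y).symm (s y) a) x)
    (ξ : TangentSpace 𝓘(ℂ) x) :
    D s x ξ = ∑ a, (φ x).symm (s x) a • D (fun y => φ y (Pi.single a 1)) x ξ +
      φ x (fun a => mvfderiv 𝓘(ℂ) (fun y => (φ y).symm (s y) a) x ξ) := by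
  have h1 : s = fun y => ∑ a, (φ y).symm (s y) a • φ y (Pi.single a 1) :=
    funext fun y => linearEquiv_apply_eq_sum (φ y) (s y)
  conv_lhs => rw [h1]
  rw [covariantDerivative_sum D Finset.univ
      (s := fun a y => (φ y).symm (s y) a • φ y (Pi.single a 1))
      (fun a => (hs a).smul_section (hφ (Pi.single a 1)).mdifferentiableAt),
    linearEquiv_apply_eq_sum (φ x).symm.symm (φ x _)]
  simp only [LinearEquiv.symm_symm, LinearEquiv.symm_apply_apply]
  rw [← Finset.sum_add_distrib, _root_.sum_apply]
  refine Finset.sum_congr rfl fun a _ => ?_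
  have := D.isCovariantDerivativeOnUniv.leibniz (hφ (Pi.single a 1)).mdifferentiableAt (hs a)
  exact congrArg (fun T : TangentSpace 𝓘(ℂ) x →L[ℂ] E x => T ξ) this

end Vector

/-! ### Symplectic frames -/

section SymplecticFrame

variable {n : ℕ}

/-- The automorphism of `ℂ²ⁿ` given by a symplectic matrix. -/
def symplecticEquiv (g : SpC n) : Std n ≃ₗ[ℂ] Std n where
  toFun v := (g : Mat n) *ᵥ v
  invFun v := ((g⁻¹ : SpC n) : Mat n) *ᵥ v
  map_add' := mulVec_add _
  map_smul' := fun c v => mulVec_smul _ c v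
  left_inv := symplectic_inv_mulVec_mulVec g
  right_inv := symplectic_mulVec_inv_mulVec g

@[simp]
theorem symplecticEquiv_apply (g : SpC n) (v : Std n) :
    symplecticEquiv g v = (g : Mat n) *ᵥ v := rfl

theorem symplectic_ext {g k : SpC n} (h : ∀ v : Std n, (g : Mat n) *ᵥ v = (k : Mat n) *ᵥ v) :
    g = k := by
  refine Subtype.ext (Matrix.ext fun i j => ?_)
  simpa using congrFun (h (Pi.single j 1)) i

/-- The symplectic frames of a `2n`-dimensional symplectic space `(W, B)`, seen as isomorphisms of
the standard symplectic space with it. -/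
def SymplecticFrame (n : ℕ) {W : Type v} [AddCommGroup W] [Module ℂ W] (B : W →ₗ[ℂ] W →ₗ[ℂ] ℂ) :
    Type v :=
  {φ : Std n ≃ₗ[ℂ] W // ∀ v w, B (φ v) (φ w) = v ⬝ᵥ (J (Fin n) ℂ *ᵥ w)}

namespace SymplecticFrame

variable {W : Type v} [AddCommGroup W] [Module ℂ W] {B : W →ₗ[ℂ] W →ₗ[ℂ] ℂ}

/-- The symplectic group acts on symplectic frames from the right by composition. -/
instance : MulAction (SpC n)ᵐᵒᵖ (SymplecticFrame n B) where
  smul g φ := ⟨(symplecticEquiv g.unop).trans φ.1, fun v w => by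
    simp only [LinearEquiv.trans_apply, φ.2, symplecticEquiv_apply, symplectic_form]⟩
  one_smul φ := Subtype.ext (LinearEquiv.ext fun v => by
    change φ.1 (((1 : SpC n) : Mat n) *ᵥ v) = φ.1 v
    rw [Submonoid.coe_one, one_mulVec])
  mul_smul g k φ := Subtype.ext (LinearEquiv.ext fun v => by
    change φ.1 (((k.unop * g.unop : SpC n) : Mat n) *ᵥ v) =
      φ.1 ((k.unop : Mat n) *ᵥ ((g.unop : Mat n) *ᵥ v))
    rw [Submonoid.coe_mul, mulVec_mulVec])

theorem smul_apply (φ : SymplecticFrame n B) (g : SpC n) (v : Std n) :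
    (φ <• g).1 v = φ.1 ((g : Mat n) *ᵥ v) := rfl

/-- The change of frame: the symplectic matrix `g` with `ψ = φ g`. -/
noncomputable def div (φ ψ : SymplecticFrame n B) : SpC n :=
  ⟨LinearMap.toMatrix' (ψ.1.trans φ.1.symm).toLinearMap, by
    rw [mem_symplecticGroup_iff_form]
    intro v w
    rw [← φ.2, ← ψ.2]
    simp [LinearMap.toMatrix'_mulVec]⟩

theorem div_mulVec (φ ψ : SymplecticFrame n B) (v : Std n) :
    (div φ ψ : Mat n) *ᵥ v = φ.1.symm (ψ.1 v) := by
  simp [div, LinearMap.toMatrix'_mulVec]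

theorem smul_div (φ ψ : SymplecticFrame n B) : φ <• div φ ψ = ψ :=
  Subtype.ext (LinearEquiv.ext fun v => by rw [smul_apply, div_mulVec, φ.1.apply_symm_apply])

theorem div_smul (φ ψ : SymplecticFrame n B) (g : SpC n) : div φ (ψ <• g) = div φ ψ * g :=
  symplectic_ext fun v => by
    rw [div_mulVec, smul_apply, Submonoid.coe_mul, ← mulVec_mulVec, div_mulVec]

theorem div_self (φ : SymplecticFrame n B) : div φ φ = 1 :=
  symplectic_ext fun v => by
    rw [div_mulVec, Submonoid.coe_one, one_mulVec, φ.1.symm_apply_apply]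

theorem div_smul_self (φ : SymplecticFrame n B) (g : SpC n) : div φ (φ <• g) = g := by
  rw [div_smul, div_self, one_mul]

/-- Symplectic frames are transported by symplectic isomorphisms. -/
def congr {W' : Type v} [AddCommGroup W'] [Module ℂ W'] {B' : W' →ₗ[ℂ] W' →ₗ[ℂ] ℂ}
    (ψ : W ≃ₗ[ℂ] W') (hψ : ∀ v w, B' (ψ v) (ψ w) = B v w) :
    SymplecticFrame n B ≃ SymplecticFrame n B' where
  toFun φ := ⟨φ.1.trans ψ, fun v w => by simp only [LinearEquiv.trans_apply, hψ, φ.2]⟩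
  invFun φ := ⟨φ.1.trans ψ.symm, fun v w => by
    rw [← hψ]; simp only [LinearEquiv.trans_apply, LinearEquiv.apply_symm_apply, φ.2]⟩
  left_inv φ := Subtype.ext (LinearEquiv.ext fun v => by simp)
  right_inv φ := Subtype.ext (LinearEquiv.ext fun v => by simp)

end SymplecticFrame

end SymplecticFrame

/-! ### Associated data -/

namespace Association

variable {X : Type u} [TopologicalSpace X] [ChartedSpace ℂ X] [IsManifold 𝓘(ℂ) ω X] {n : ℕ}
  {f h : Mat n} {𝓟 𝓠 : GPOper.{u, v} X f h} {𝓔 𝓕 : BOper.{u, v} X n} {x : X}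

theorem _root_.Opers.GPOper.nonempty (𝓟 : GPOper.{u, v} X f h) (x : X) : Nonempty (𝓟.P x) :=
  let ⟨s, _⟩ := 𝓟.reduction.exists_section x
  ⟨s x⟩

theorem _root_.Opers.GPOper.exists_holPSectionAt (𝓟 : GPOper.{u, v} X f h) (x : X) :
    ∃ s : ∀ y, 𝓟.P y, HolPSectionAt n s x :=
  let ⟨s, hs, _⟩ := 𝓟.reduction.exists_section x
  ⟨s, hs⟩

/-- The points of the principal bundle, as symplectic frames of the vector bundle. -/
def toFrame (α : Association 𝓟 𝓔) (p : 𝓟.P x) : SymplecticFrame n (𝓔.B x) :=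
  ⟨α.frame x p, α.form x p⟩

theorem toFrame_smul (α : Association 𝓟 𝓔) (p : 𝓟.P x) (g : SpC n) :
    α.toFrame (p <• g) = α.toFrame p <• g :=
  Subtype.ext (LinearEquiv.ext fun v => α.equivariant x p g v)

/-- The structure group acts simply transitively on a fibre of the principal bundle and on the
symplectic frames of a fibre of the vector bundle. -/
theorem toFrame_bijective (α : Association 𝓟 𝓔) (x : X) :
    Function.Bijective (α.toFrame (x := x)) := by
  constructor
  · intro p q hpq
    have h1 : α.toFrame q = α.toFrame p <• (fibreDiv p q : SpC n) := by
      rw [← toFrame_smul, smul_fibreDiv]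
    have h2 : (fibreDiv p q : SpC n) = 1 := by
      rw [← SymplecticFrame.div_smul_self (α.toFrame p) (fibreDiv p q), ← h1, ← hpq,
        SymplecticFrame.div_self]
    rw [← smul_fibreDiv (n := n) p q, h2, MulOpposite.op_one, one_smul]
  · intro φ
    obtain ⟨p⟩ := 𝓟.nonempty x
    exact ⟨p <• SymplecticFrame.div (α.toFrame p) φ, by
      rw [toFrame_smul, SymplecticFrame.smul_div]⟩

theorem frame_fibreDiv (α : Association 𝓟 𝓔) (p q : 𝓟.P x) (v : Std n) :
    ((fibreDiv p q : SpC n) : Mat n) *ᵥ v = (α.frame x p).symm (α.frame x q v) := by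
  rw [LinearEquiv.eq_symm_apply, ← α.equivariant, smul_fibreDiv]

theorem holSectionAt_iff (α : Association 𝓟 𝓔) {p : ∀ y, 𝓟.P y} (hp : HolPSectionAt n p x)
    {s : ∀ y, 𝓔.E y} :
    HolSectionAt n s x ↔ ∀ a, HolAt (fun y => (α.frame y (p y)).symm (s y) a) x :=
  holSectionAt_iff_coord 𝓔.symplectic (fun v => α.holomorphic p x hp v) fun y => α.form y (p y)

/-- A section of the principal bundle is holomorphic if and only if its frames are. -/
theorem holPSectionAt_iff (α : Association 𝓟 𝓔) {s : ∀ y, 𝓟.P y} :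
    HolPSectionAt n s x ↔ ∀ v, HolSectionAt n (fun y => α.frame y (s y) v) x := by
  refine ⟨fun hs v => α.holomorphic s x hs v, fun hs => ?_⟩
  obtain ⟨p, hp⟩ := 𝓟.exists_holPSectionAt x
  refine hp.of_fibreDiv (holGroupAt_iff_mulVec.2 fun v i => ?_)
  simp only [α.frame_fibreDiv]
  exact (α.holSectionAt_iff hp).1 (hs v) i

/-- The connection in the frame given by a section of the principal bundle: `D = d + s^*ω`. -/
theorem conn_apply (α : Association 𝓟 𝓔) {p : ∀ y, 𝓟.P y} (hp : HolPSectionAt n p x)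
    {s : ∀ y, 𝓔.E y} (hs : HolSectionAt n s x) (ξ : TangentSpace 𝓘(ℂ) x) :
    𝓔.D s x ξ = α.frame x (p x) (𝓟.conn.pullback p x ξ *ᵥ (α.frame x (p x)).symm (s x) +
      fun a => mvfderiv 𝓘(ℂ) (fun y => (α.frame y (p y)).symm (s y) a) x ξ) := by
  rw [covariantDerivative_frame 𝓔.D (φ := fun y => α.frame y (p y))
    (fun v => α.holomorphic p x hp v)
    (fun a => ((α.holSectionAt_iff hp).1 hs a).mdifferentiableAt) ξ, map_add]
  congr 1
  simp only [α.conn p x hp, ← map_smul, ← map_sum, ← mulVec_smul, ← mulVec_sum]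
  congr 2
  exact (linearEquiv_apply_eq_sum (LinearEquiv.refl ℂ (Std n)) _).symm

/-- An isomorphism of opers induces one of associated bundles: in the fibre it is the isomorphism
taking the frame of a point `p` to the frame of the image of `p`, whatever `p` is. -/
theorem exists_map (α : Association 𝓟 𝓔) (β : Association 𝓠 𝓕) (m : 𝓟 ⟶ 𝓠) :
    ∃ ψ : 𝓔 ⟶ 𝓕, ∀ x p w,
      ψ.toEquiv x (α.frame x p w) = β.frame x (m.toEquiv x p) w := by
  let b : ∀ x, 𝓟.P x := fun x => Classical.choice (𝓟.nonempty x)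
  let ψ : ∀ x, 𝓔.E x ≃ₗ[ℂ] 𝓕.E x := fun x =>
    (α.frame x (b x)).symm.trans (β.frame x (m.toEquiv x (b x)))
  have key : ∀ x p w, ψ x (α.frame x p w) = β.frame x (m.toEquiv x p) w := by
    intro x p w
    simp only [ψ, LinearEquiv.trans_apply]
    rw [← α.frame_fibreDiv, ← β.equivariant, ← m.equivariant, smul_fibreDiv]
  have key' : ∀ x p w, (β.frame x (m.toEquiv x p)).symm (ψ x w) = (α.frame x p).symm w := by
    intro x p w
    rw [LinearEquiv.symm_apply_eq, ← key, LinearEquiv.apply_symm_apply]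
  refine ⟨⟨ψ, fun s x => ?_, fun x v w => ?_, fun x v => ?_, fun s x hs ξ => ?_⟩, key⟩
  · obtain ⟨p, hp⟩ := 𝓟.exists_holPSectionAt x
    rw [α.holSectionAt_iff hp, β.holSectionAt_iff ((m.holomorphic p x).2 hp)]
    simp only [key']
  · obtain ⟨v, rfl⟩ := (α.frame x (b x)).surjective v
    obtain ⟨w, rfl⟩ := (α.frame x (b x)).surjective w
    rw [key, key, α.form, β.form]
  · obtain ⟨s, -, hs⟩ := 𝓟.reduction.exists_section x
    have hp := hs.self_of_nhds
    rw [← (β.filtration x _).1 ((m.map_reduction x _).2 hp), ← (α.filtration x _).1 hp]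
    simp only [Submodule.mem_map]
    refine exists_congr fun w => and_congr_right fun _ => ?_
    change β.frame x (m.toEquiv x (s x)) w = ψ x v ↔ α.frame x (s x) w = v
    rw [← key, (ψ x).injective.eq_iff]
  · obtain ⟨p, hp⟩ := 𝓟.exists_holPSectionAt x
    have hmp := (m.holomorphic p x).2 hp
    rw [α.conn_apply hp hs, key, β.conn_apply hmp, m.map_conn p x hp]
    · simp only [key']
    · rw [β.holSectionAt_iff hmp]
      simp only [key']
      exact (α.holSectionAt_iff hp).1 hs

/-- An isomorphism of associated bundles takes symplectic frames to symplectic frames, that is,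
points of one principal bundle to points of the other. -/
theorem exists_lift (α : Association 𝓟 𝓔) (β : Association 𝓠 𝓕) (ψ : 𝓔 ⟶ 𝓕) :
    ∃ m : 𝓟 ⟶ 𝓠, ∀ x p w,
      ψ.toEquiv x (α.frame x p w) = β.frame x (m.toEquiv x p) w := by
  let m : ∀ x, 𝓟.P x ≃ 𝓠.P x := fun x =>
    (Equiv.ofBijective _ (α.toFrame_bijective x)).trans
      ((SymplecticFrame.congr (ψ.toEquiv x) (ψ.map_form x)).trans
        (Equiv.ofBijective _ (β.toFrame_bijective x)).symm)
  have hm : ∀ x p, β.toFrame (m x p) =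
      SymplecticFrame.congr (ψ.toEquiv x) (ψ.map_form x) (α.toFrame p) := by
    intro x p
    exact (Equiv.ofBijective _ (β.toFrame_bijective x)).apply_symm_apply _
  have key : ∀ x p w, ψ.toEquiv x (α.frame x p w) = β.frame x (m x p) w := by
    intro x p w
    exact (congrArg (fun φ : SymplecticFrame n (𝓕.B x) => φ.1 w) (hm x p)).symm
  have hhol : ∀ s x, HolPSectionAt n (fun y => m y (s y)) x ↔ HolPSectionAt n s x := by
    intro s x
    rw [α.holPSectionAt_iff, β.holPSectionAt_iff]
    simp only [← key, ψ.holomorphic]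
  refine ⟨⟨m, fun x p g => ?_, hhol, fun x p => ?_, fun s x hs => ?_⟩, key⟩
  · refine (β.toFrame_bijective x).1 (Subtype.ext (LinearEquiv.ext fun v => ?_))
    change β.frame x _ v = β.frame x _ v
    rw [β.equivariant, ← key, ← key, α.equivariant]
  · have hcomp : (stdLagrangian n).map (β.frame x (m x p)).toLinearMap =
        ((stdLagrangian n).map (α.frame x p).toLinearMap).map (ψ.toEquiv x).toLinearMap := by
      rw [← Submodule.map_comp]
      congr 1
      exact LinearMap.ext fun w => (key x p w).symm
    have hF : 𝓕.F₁ x = (𝓔.F₁ x).map (ψ.toEquiv x).toLinearMap := by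
      ext w
      obtain ⟨v, rfl⟩ := (ψ.toEquiv x).surjective w
      rw [ψ.map_filtration]
      exact ((Submodule.mem_map_equiv (𝓔.F₁ x) (e := ψ.toEquiv x)).trans (by simp)).symm
    rw [α.filtration, β.filtration, hcomp, hF]
    exact (Submodule.map_injective_of_injective (ψ.toEquiv x).injective).eq_iff
  · refine LinearMap.ext fun ξ => ?_
    have hv : ∀ v, 𝓠.conn.pullback (fun y => m y (s y)) x ξ *ᵥ v =
        𝓟.conn.pullback s x ξ *ᵥ v := by
      intro v
      apply (β.frame x (m x (s x))).injective
      rw [← β.conn _ x ((hhol s x).2 hs), ← key, ← α.conn s x hs,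
        ← ψ.map_conn _ x (α.holomorphic s x hs v)]
      simp only [key]
    exact Matrix.ext fun i j => by simpa using congrFun (hv (Pi.single j 1)) i

theorem map_unique (α : Association 𝓟 𝓔) {ψ ψ' : 𝓔 ⟶ 𝓕}
    (hψ : ∀ x p w, ψ.toEquiv x (α.frame x p w) = ψ'.toEquiv x (α.frame x p w)) : ψ = ψ' := by
  refine BOper.Iso.ext (funext fun x => LinearEquiv.ext fun v => ?_)
  obtain ⟨p⟩ := 𝓟.nonempty x
  obtain ⟨w, rfl⟩ := (α.frame x p).surjective v
  exact hψ x p w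

theorem lift_unique (β : Association 𝓠 𝓕) {m m' : 𝓟 ⟶ 𝓠}
    (hm : ∀ x p w, β.frame x (m.toEquiv x p) w = β.frame x (m'.toEquiv x p) w) : m = m' := by
  refine GPOper.Iso.ext (funext fun x => Equiv.ext fun p => ?_)
  exact (β.toFrame_bijective x).1 (Subtype.ext (LinearEquiv.ext fun w => hm x p w))

end Association

/-! ### Vector bundles from holomorphic frames -/

section FrameAtlas

variable {X : Type u} [TopologicalSpace X] [ChartedSpace ℂ X] {n : ℕ}
  {E : X → Type v} [∀ x, AddCommGroup (E x)] [∀ x, Module ℂ (E x)] [∀ x, TopologicalSpace (E x)]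

variable (n E) in
/-- A family of local frames of a family `E` of vector spaces, one around each point, with
holomorphic changes of frame. The frame at `x` has to induce the given topology on the fibre over
`x`. -/
structure FrameAtlas where
  dom : X → Set X
  isOpen_dom : ∀ x, IsOpen (dom x)
  mem_dom : ∀ x, x ∈ dom x
  frame : X → ∀ y, Std n ≃ₗ[ℂ] E y
  holomorphic : ∀ x x', ∀ y ∈ dom x ∩ dom x', ∀ v i,
    HolAt (fun z => (frame x' z).symm (frame x z v) i) y
  isInducing : ∀ x, Topology.IsInducing (frame x x).symm

namespace FrameAtlas

variable (𝓐 : FrameAtlas n E)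

/-- The pretrivialization given by a frame. -/
def pretriv (x : X) : Pretrivialization (Std n) (π (Std n) E) where
  toFun z := (z.proj, (𝓐.frame x z.proj).symm z.2)
  invFun z := ⟨z.1, 𝓐.frame x z.1 z.2⟩
  source := π (Std n) E ⁻¹' 𝓐.dom x
  target := 𝓐.dom x ×ˢ Set.univ
  map_source' _ hz := ⟨hz, trivial⟩
  map_target' _ hz := hz.1
  left_inv' z _ := by simp
  right_inv' z _ := by simp
  open_target := (𝓐.isOpen_dom x).prod isOpen_univ
  baseSet := 𝓐.dom x
  open_baseSet := 𝓐.isOpen_dom x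
  source_eq := rfl
  target_eq := rfl
  proj_toFun _ _ := rfl

/-- The change of frame, as a family of continuous linear maps. -/
noncomputable def change (x x' y : X) : Std n →L[ℂ] Std n :=
  ((𝓐.frame x y).trans (𝓐.frame x' y).symm).toLinearMap.toContinuousLinearMap

theorem pretriv_symm (x : X) {y : X} (hy : y ∈ 𝓐.dom x) (v : Std n) :
    (𝓐.pretriv x).symm y v = 𝓐.frame x y v := by
  rw [Pretrivialization.symm_apply (𝓐.pretriv x) hy]
  rfl

theorem contMDiffOn_change (x x' : X) :
    ContMDiffOn 𝓘(ℂ) 𝓘(ℂ, Std n →L[ℂ] Std n) ω (𝓐.change x x') (𝓐.dom x ∩ 𝓐.dom x') := by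
  have h1 : 𝓐.change x x' = fun y => ∑ j, ∑ i,
      (𝓐.frame x' y).symm (𝓐.frame x y (Pi.single j 1)) i •
        (ContinuousLinearMap.proj (R := ℂ) (φ := fun _ : Fin n ⊕ Fin n => ℂ) j).smulRight
          (Pi.single i 1 : Std n) := by
    funext y
    refine ContinuousLinearMap.ext fun v => ?_
    simp only [change, LinearMap.coe_toContinuousLinearMap', _root_.sum_apply,
      _root_.smul_apply, ContinuousLinearMap.smulRight_apply, ContinuousLinearMap.proj_apply]
    set L := (𝓐.frame x y).trans (𝓐.frame x' y).symm
    have h2 := congrArg L (linearEquiv_apply_eq_sum (LinearEquiv.refl ℂ (Std n)) v)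
    refine h2.trans ?_
    rw [map_sum]
    refine Finset.sum_congr rfl fun j _ => ?_
    rw [map_smul, linearEquiv_apply_eq_sum (LinearEquiv.refl ℂ (Std n)) (L _), Finset.smul_sum]
    refine Finset.sum_congr rfl fun i _ => ?_
    exact smul_comm _ _ _
  rw [h1]
  intro y hy
  refine ContMDiffAt.contMDiffWithinAt ?_
  refine ContMDiffAt.sum fun j _ => ContMDiffAt.sum fun i _ => ?_
  exact ContMDiffAt.smul (𝓐.holomorphic x x' y hy (Pi.single j 1) i) contMDiffAt_const

/-- The vector bundle structure given by an atlas of frames. -/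
noncomputable def prebundle : VectorPrebundle ℂ (Std n) E where
  pretrivializationAtlas := Set.range 𝓐.pretriv
  pretrivialization_linear' := by
    rintro _ ⟨x, rfl⟩
    exact ⟨fun y _ => (𝓐.frame x y).symm.toLinearMap.isLinear⟩
  pretrivializationAt := 𝓐.pretriv
  mem_base_pretrivializationAt := 𝓐.mem_dom
  pretrivialization_mem_atlas x := ⟨x, rfl⟩
  exists_coordChange := by
    rintro _ ⟨x, rfl⟩ _ ⟨x', rfl⟩
    refine ⟨𝓐.change x x', (𝓐.contMDiffOn_change x x').continuousOn, fun y hy v => ?_⟩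
    rw [𝓐.pretriv_symm x hy.1]
    rfl
  totalSpaceMk_isInducing x := Topology.isInducing_const_prod.2 (𝓐.isInducing x)

instance : 𝓐.prebundle.IsContMDiff 𝓘(ℂ) ω where
  exists_contMDiffCoordChange := by
    rintro _ ⟨x, rfl⟩ _ ⟨x', rfl⟩
    refine ⟨𝓐.change x x', 𝓐.contMDiffOn_change x x', fun y hy v => ?_⟩
    rw [𝓐.pretriv_symm x hy.1]
    rfl

end FrameAtlas

end FrameAtlas

/-- In dimension one, a one-form with values in a vector bundle is holomorphic if its values on
holomorphic vector fields are. -/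
theorem contMDiffAt_hom_of_holSectionAt {X : Type u} [TopologicalSpace X] [ChartedSpace ℂ X]
    [IsManifold 𝓘(ℂ) ω X] {n : ℕ} {E : X → Type v} [∀ x, AddCommGroup (E x)]
    [∀ x, Module ℂ (E x)] [TopologicalSpace (TotalSpace (Std n) E)] [∀ x, TopologicalSpace (E x)]
    [FiberBundle (Std n) E] [∀ x, IsTopologicalAddGroup (E x)] [∀ x, ContinuousSMul ℂ (E x)]
    [VectorBundle ℂ (Std n) E] {x : X}
    {T : ∀ y : X, TangentSpace 𝓘(ℂ) y →L[ℂ] E y}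
    (hT : ∀ V, HolVectorFieldAt V x → HolSectionAt n (fun y => T y (V y)) x) :
    ContMDiffAt 𝓘(ℂ) (𝓘(ℂ).prod 𝓘(ℂ, ℂ →L[ℂ] Std n)) ω
      (fun y => (⟨y, T y⟩ : TotalSpace (ℂ →L[ℂ] Std n) fun y => TangentSpace 𝓘(ℂ) y →L[ℂ] E y))
      x := by
  let e := trivializationAt ℂ (TangentSpace 𝓘(ℂ) : X → Type _) x
  let V : ∀ y : X, TangentSpace 𝓘(ℂ) y := fun y => e.symmL ℂ y 1
  have hx : x ∈ e.baseSet := mem_baseSet_trivializationAt _ _ _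
  have hV : HolVectorFieldAt V x := by
    refine (contMDiffAt_section x).2 ?_
    refine (contMDiffAt_const (c := (1 : ℂ))).congr_of_eventuallyEq ?_
    filter_upwards [e.open_baseSet.mem_nhds hx] with y hy
    change (e ⟨y, e.symmL ℂ y 1⟩).2 = 1
    rw [e.symmL_apply hy, e.apply_mk_symm hy]
  have h := (contMDiffAt_section x).1 (hT V hV)
  rw [contMDiffAt_hom_bundle]
  refine ⟨contMDiffAt_id, ?_⟩
  -- a linear map out of `ℂ` is determined by its value at `1`
  have hL := ((ContinuousLinearMap.smulRightL ℂ ℂ (Std n) (ContinuousLinearMap.id ℂ ℂ)).contMDiff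
    (n := ω)).contMDiffAt.comp x h
  refine hL.congr_of_eventuallyEq ?_
  filter_upwards [(trivializationAt (Std n) E x).open_baseSet.mem_nhds
    (mem_baseSet_trivializationAt _ _ _)] with y hy
  refine ContinuousLinearMap.ext_ring ?_
  simp [ContinuousLinearMap.inCoordinates, V, e, Trivialization.linearMapAt_apply, hy]

/-! ### The associated vector bundle of an oper -/

section Linear

variable {n : ℕ}

theorem span_single_inl :
    Submodule.span ℂ (Set.range fun i : Fin n => (Pi.single (Sum.inl i) 1 : Std n)) =
      stdLagrangian n := by
  apply le_antisymm
  · rw [Submodule.span_le]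
    rintro _ ⟨i, rfl⟩
    simp [mem_stdLagrangian]
  · intro v hv
    rw [mem_stdLagrangian] at hv
    have h := linearEquiv_apply_eq_sum (LinearEquiv.refl ℂ (Std n)) v
    rw [Fintype.sum_sum_type] at h
    simp only [LinearEquiv.refl_symm, LinearEquiv.refl_apply, hv, zero_smul,
      Finset.sum_const_zero, add_zero] at h
    rw [h]
    exact Submodule.sum_mem _ fun i _ =>
      Submodule.smul_mem _ _ (Submodule.subset_span ⟨i, rfl⟩)

theorem linearIndependent_single_inl :
    LinearIndependent ℂ fun i : Fin n => (Pi.single (Sum.inl i) 1 : Std n) := by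
  have := (Pi.basisFun ℂ (Fin n ⊕ Fin n)).linearIndependent.comp _
    (Sum.inl_injective (α := Fin n) (β := Fin n))
  simpa [Function.comp_def] using this

/-- A symplectic matrix stabilizes `ℂⁿ ⊕ 0` if and only if it lies in the parabolic. -/
theorem map_stdLagrangian_eq_iff {g : SpC n} :
    (stdLagrangian n).map (symplecticEquiv g).toLinearMap = stdLagrangian n ↔
      g ∈ parabolic (gradingElement n) := by
  rw [mem_parabolic_iff]
  constructor
  · intro h v
    conv_lhs => rw [← h]
    exact (Submodule.mem_map_equiv _ (e := symplecticEquiv g)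
      (x := (g : Mat n) *ᵥ v)).trans (by
        rw [← symplecticEquiv_apply, LinearEquiv.symm_apply_apply])
  · intro h
    ext v
    refine (Submodule.mem_map_equiv _ (e := symplecticEquiv g)).trans ?_
    rw [← h, ← symplecticEquiv_apply, LinearEquiv.apply_symm_apply]

end Linear

section AssocFibre

variable {X : Type u} [TopologicalSpace X] [ChartedSpace ℂ X] [IsManifold 𝓘(ℂ) ω X] {n : ℕ}
  {f h : Mat n} (𝓟 : GPOper.{u, v} X f h)

namespace GPOper

/-- A section of the reduction, holomorphic around `x`. -/
noncomputable def localSection (x : X) : ∀ y, 𝓟.P y :=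
  (𝓟.reduction.exists_section x).choose

theorem holPSectionAt_localSection (x : X) : HolPSectionAt n (𝓟.localSection x) x :=
  (𝓟.reduction.exists_section x).choose_spec.1

theorem localSection_mem (x : X) : ∀ᶠ y in 𝓝 x, 𝓟.localSection x y ∈ 𝓟.Q y :=
  (𝓟.reduction.exists_section x).choose_spec.2

/-- An open neighbourhood of `x` on which the local section at `x` is holomorphic. -/
def localDomain (x : X) : Set X :=
  interior {y | HolPSectionAt n (𝓟.localSection x) y ∧ 𝓟.localSection x y ∈ 𝓟.Q y}

theorem mem_localDomain (x : X) : x ∈ 𝓟.localDomain x :=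
  mem_interior_iff_mem_nhds.2 ((𝓟.holPSectionAt_localSection x).eventually.and
    (𝓟.localSection_mem x))

theorem holPSectionAt_of_mem {x y : X} (hy : y ∈ 𝓟.localDomain x) :
    HolPSectionAt n (𝓟.localSection x) y :=
  (interior_subset hy).1

/-- A base point in each fibre of the principal bundle, in the reduction. -/
noncomputable def basePoint (x : X) : 𝓟.P x := 𝓟.localSection x x

theorem basePoint_mem (x : X) : 𝓟.basePoint x ∈ 𝓟.Q x := (𝓟.localSection_mem x).self_of_nhds

/-- The fibre of the associated bundle `P ×_G ℂ²ⁿ`. It is identified with `ℂ²ⁿ` (in the universe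
of the fibres of `P`) by `v ↦ [b, v]`, where `b` is the base point of the fibre of `P`. -/
def AssocFibre (_ : GPOper.{u, v} X f h) (_ : X) : Type v := ULift.{v} (Std n)

noncomputable instance (x : X) : AddCommGroup (𝓟.AssocFibre x) :=
  inferInstanceAs (AddCommGroup (ULift.{v} (Std n)))

noncomputable instance (x : X) : Module ℂ (𝓟.AssocFibre x) :=
  inferInstanceAs (Module ℂ (ULift.{v} (Std n)))

instance (x : X) : TopologicalSpace (𝓟.AssocFibre x) :=
  inferInstanceAs (TopologicalSpace (ULift.{v} (Std n)))

instance (x : X) : IsTopologicalAddGroup (𝓟.AssocFibre x) :=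
  inferInstanceAs (IsTopologicalAddGroup (ULift.{v} (Std n)))

instance (x : X) : ContinuousSMul ℂ (𝓟.AssocFibre x) :=
  inferInstanceAs (ContinuousSMul ℂ (ULift.{v} (Std n)))

/-- The identification `v ↦ [b, v]` of `ℂ²ⁿ` with a fibre, for the base point `b`. -/
noncomputable def baseFrame (x : X) : Std n ≃ₗ[ℂ] 𝓟.AssocFibre x :=
  (ULift.moduleEquiv (R := ℂ) (M := Std n)).symm

/-- The identification `v ↦ [p, v]` of `ℂ²ⁿ` with the fibre of the associated bundle. -/
noncomputable def assocFrame (x : X) (p : 𝓟.P x) : Std n ≃ₗ[ℂ] 𝓟.AssocFibre x :=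
  (symplecticEquiv (fibreDiv (𝓟.basePoint x) p)).trans (𝓟.baseFrame x)

theorem assocFrame_apply (x : X) (p : 𝓟.P x) (v : Std n) :
    𝓟.assocFrame x p v =
      𝓟.baseFrame x (((fibreDiv (𝓟.basePoint x) p : SpC n) : Mat n) *ᵥ v) := rfl

theorem assocFrame_smul (x : X) (p : 𝓟.P x) (g : SpC n) (v : Std n) :
    𝓟.assocFrame x (p <• g) v = 𝓟.assocFrame x p ((g : Mat n) *ᵥ v) := by
  rw [assocFrame_apply, assocFrame_apply, fibreDiv_smul_right, Submonoid.coe_mul, mulVec_mulVec]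

theorem assocFrame_symm_assocFrame (x : X) (p q : 𝓟.P x) (v : Std n) :
    (𝓟.assocFrame x p).symm (𝓟.assocFrame x q v) =
      ((fibreDiv p q : SpC n) : Mat n) *ᵥ v := by
  rw [LinearEquiv.symm_apply_eq, ← assocFrame_smul, smul_fibreDiv]

theorem assocFrame_basePoint (x : X) : 𝓟.assocFrame x (𝓟.basePoint x) = 𝓟.baseFrame x := by
  ext v
  rw [assocFrame_apply, fibreDiv_self, Submonoid.coe_one, one_mulVec]

/-- The frames of the associated bundle given by the local sections of the principal bundle. -/
noncomputable def assocAtlas : FrameAtlas n 𝓟.AssocFibre where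
  dom := 𝓟.localDomain
  isOpen_dom _ := isOpen_interior
  mem_dom := 𝓟.mem_localDomain
  frame x y := 𝓟.assocFrame y (𝓟.localSection x y)
  holomorphic x x' y hy v i := by
    simp only [assocFrame_symm_assocFrame]
    exact ((𝓟.holPSectionAt_of_mem hy.2).fibreDiv (𝓟.holPSectionAt_of_mem hy.1)).mulVec
      (c := fun _ => v) (fun i => HolAt.const (v i)) i
  isInducing x := by
    change Topology.IsInducing (𝓟.assocFrame x (𝓟.basePoint x)).symm
    rw [assocFrame_basePoint]
    exact Homeomorph.ulift.isInducing

noncomputable instance : TopologicalSpace (TotalSpace (Std n) 𝓟.AssocFibre) :=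
  𝓟.assocAtlas.prebundle.totalSpaceTopology

noncomputable instance : FiberBundle (Std n) 𝓟.AssocFibre :=
  𝓟.assocAtlas.prebundle.toFiberBundle

instance : VectorBundle ℂ (Std n) 𝓟.AssocFibre :=
  𝓟.assocAtlas.prebundle.toVectorBundle

instance : ContMDiffVectorBundle ω (Std n) 𝓟.AssocFibre 𝓘(ℂ) :=
  𝓟.assocAtlas.prebundle.contMDiffVectorBundle 𝓘(ℂ)

/-- The coordinates of a section of the associated bundle in the frame given by `p`. -/
noncomputable def coord (p : ∀ y, 𝓟.P y) (s : ∀ y, 𝓟.AssocFibre y) (y : X) : Std n :=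
  (𝓟.assocFrame y (p y)).symm (s y)

theorem assocFrame_coord (p : ∀ y, 𝓟.P y) (s : ∀ y, 𝓟.AssocFibre y) (y : X) :
    𝓟.assocFrame y (p y) (𝓟.coord p s y) = s y :=
  LinearEquiv.apply_symm_apply _ _

theorem coord_eq_fibreDiv_mulVec (p q : ∀ y, 𝓟.P y) (s : ∀ y, 𝓟.AssocFibre y) (y : X) :
    𝓟.coord p s y = ((fibreDiv (p y) (q y) : SpC n) : Mat n) *ᵥ 𝓟.coord q s y := by
  rw [← assocFrame_symm_assocFrame, assocFrame_coord, coord]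

variable {𝓟} {x : X} {s : ∀ y, 𝓟.AssocFibre y}

theorem holSectionAt_iff_coord_localSection :
    HolSectionAt n s x ↔ ∀ i, HolAt (fun y => 𝓟.coord (𝓟.localSection x) s y i) x :=
  (contMDiffAt_section x).trans contMDiffAt_pi_iff_holAt

theorem mdifferentiableAt_iff_coord_localSection :
    MDifferentiableAt 𝓘(ℂ) (𝓘(ℂ).prod 𝓘(ℂ, Std n)) (fun y => TotalSpace.mk' (Std n) y (s y)) x ↔
      ∀ i, MDifferentiableAt 𝓘(ℂ) 𝓘(ℂ) (fun y => 𝓟.coord (𝓟.localSection x) s y i) x :=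
  (mdifferentiableAt_section 𝓘(ℂ) s).trans mdifferentiableAt_pi_iff

theorem holSectionAt_iff_coord' {p : ∀ y, 𝓟.P y} (hp : HolPSectionAt n p x) :
    HolSectionAt n s x ↔ ∀ i, HolAt (fun y => 𝓟.coord p s y i) x := by
  have hq := 𝓟.holPSectionAt_localSection x
  rw [holSectionAt_iff_coord_localSection]
  constructor
  · intro h i
    simp only [𝓟.coord_eq_fibreDiv_mulVec p (𝓟.localSection x) s]
    exact (hp.fibreDiv hq).mulVec h i
  · intro h i
    simp only [𝓟.coord_eq_fibreDiv_mulVec (𝓟.localSection x) p s]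
    exact (hq.fibreDiv hp).mulVec h i

theorem holSectionAt_assocFrame {p : ∀ y, 𝓟.P y} (hp : HolPSectionAt n p x) (v : Std n) :
    HolSectionAt n (fun y => 𝓟.assocFrame y (p y) v) x := by
  rw [holSectionAt_iff_coord' hp]
  simp only [coord, LinearEquiv.symm_apply_apply]
  exact fun i => HolAt.const _

/-- The covariant derivative in the frame of the section `p`: `[p, c] ↦ [p, dc + (p^*ω) c]`. -/
noncomputable def assocDeriv (p : ∀ y, 𝓟.P y) (s : ∀ y, 𝓟.AssocFibre y) (x : X) :
    TangentSpace 𝓘(ℂ) x →ₗ[ℂ] 𝓟.AssocFibre x where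
  toFun ξ := 𝓟.assocFrame x (p x) (𝓟.conn.pullback p x ξ *ᵥ 𝓟.coord p s x +
    fun i => mvfderiv 𝓘(ℂ) (fun y => 𝓟.coord p s y i) x ξ)
  map_add' ξ η := by
    rw [← map_add, (𝓟.conn.pullback p x).map_add, add_mulVec]
    congr 1
    simp only [map_add]
    ext i
    simp only [Pi.add_apply]
    ring
  map_smul' c ξ := by
    rw [RingHom.id_apply, ← map_smul, map_smul, smul_mulVec, smul_add]
    congr 2
    ext i
    simp

/-- The covariant derivative does not depend on the frame. -/
theorem assocDeriv_eq {p q : ∀ y, 𝓟.P y} (hp : HolPSectionAt n p x) (hq : HolPSectionAt n q x)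
    (hs : ∀ i, MDifferentiableAt 𝓘(ℂ) 𝓘(ℂ) (fun y => 𝓟.coord q s y i) x) :
    assocDeriv p s x = assocDeriv q s x := by
  refine LinearMap.ext fun ξ => ?_
  have hg := hp.fibreDiv hq
  set g : X → SpC n := fun y => fibreDiv (p y) (q y) with hgdef
  have hc : 𝓟.coord p s = fun y => (g y : Mat n) *ᵥ 𝓟.coord q s y :=
    funext fun y => 𝓟.coord_eq_fibreDiv_mulVec p q s y
  have hq' : 𝓟.assocFrame x (q x) = (symplecticEquiv (g x)).trans (𝓟.assocFrame x (p x)) := by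
    ext v
    rw [LinearEquiv.trans_apply, symplecticEquiv_apply, ← assocFrame_smul, smul_fibreDiv]
  change 𝓟.assocFrame x (p x) _ = 𝓟.assocFrame x (q x) _
  rw [hq', LinearEquiv.trans_apply, symplecticEquiv_apply]
  congr 1
  have hd : (fun i => mvfderiv 𝓘(ℂ) (fun y => 𝓟.coord p s y i) x ξ) =
      dGroup g x ξ *ᵥ 𝓟.coord q s x +
        (g x : Mat n) *ᵥ fun j => mvfderiv 𝓘(ℂ) (fun y => 𝓟.coord q s y j) x ξ := by
    funext i
    simp only [hc]
    exact dGroup_mulVec hg ξ hs i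
  rw [hd, 𝓟.conn.pullback_eq hp hq, mulVec_add, add_mulVec, mulVec_add, hc]
  simp only [Ad, inv_inv, ← mulVec_mulVec]
  rw [symplectic_mulVec_inv_mulVec]
  change _ = _ + (g x : Mat n) *ᵥ (((g x)⁻¹ : SpC n) : Mat n) *ᵥ _ + _
  rw [symplectic_mulVec_inv_mulVec, add_assoc]

end GPOper

end AssocFibre

section AssocOper

variable {X : Type u} [TopologicalSpace X] [ChartedSpace ℂ X] {x : X} {n : ℕ}

instance (x : X) : T2Space (TangentSpace 𝓘(ℂ) x) := inferInstanceAs (T2Space ℂ)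

instance (x : X) : FiniteDimensional ℂ (TangentSpace 𝓘(ℂ) x) :=
  inferInstanceAs (FiniteDimensional ℂ ℂ)

theorem mvfderiv_eq_zero_of_eventually_eq_zero {φ : X → ℂ} (h : ∀ᶠ y in 𝓝 x, φ y = 0) :
    mvfderiv 𝓘(ℂ) φ x = 0 := by
  have : φ =ᶠ[𝓝 x] fun _ => (0 : ℂ) := h
  rw [mvfderiv, this.mfderiv_eq, mfderiv_const]
  rfl

/-- The Leibniz rule for the standard symplectic form. -/
theorem mvfderiv_dotProduct_J {c d : X → Std n}
    (hc : ∀ i, MDifferentiableAt 𝓘(ℂ) 𝓘(ℂ) (fun y => c y i) x)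
    (hd : ∀ i, MDifferentiableAt 𝓘(ℂ) 𝓘(ℂ) (fun y => d y i) x) (ξ : TangentSpace 𝓘(ℂ) x) :
    mvfderiv 𝓘(ℂ) (fun y => c y ⬝ᵥ (J (Fin n) ℂ *ᵥ d y)) x ξ =
      (fun i => mvfderiv 𝓘(ℂ) (fun y => c y i) x ξ) ⬝ᵥ (J (Fin n) ℂ *ᵥ d x) +
      c x ⬝ᵥ (J (Fin n) ℂ *ᵥ fun i => mvfderiv 𝓘(ℂ) (fun y => d y i) x ξ) := by
  -- `J` is a constant symplectic matrix
  let j : X → SpC n := fun _ => ⟨J (Fin n) ℂ, SymplecticGroup.J_mem _ _⟩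
  have hj : HolGroupAt j x := HolGroupAt.const _
  have hJd : ∀ i, MDifferentiableAt 𝓘(ℂ) 𝓘(ℂ) (fun y => (J (Fin n) ℂ *ᵥ d y) i) x := fun i =>
    (mvfderiv_sum_mul Finset.univ (fun k => (hj i k).mdifferentiableAt) hd ξ).1
  have hJd' : ∀ i, mvfderiv 𝓘(ℂ) (fun y => (J (Fin n) ℂ *ᵥ d y) i) x ξ =
      (J (Fin n) ℂ *ᵥ fun k => mvfderiv 𝓘(ℂ) (fun y => d y k) x ξ) i := by
    intro i
    have := dGroup_mulVec hj ξ hd i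
    rwa [dGroup_eq_zero_of_eventually_const (Filter.Eventually.of_forall fun _ => rfl), zero_mulVec,
      Pi.zero_apply, zero_add] at this
  simp only [dotProduct]
  rw [(mvfderiv_sum_mul Finset.univ hc hJd ξ).2, Finset.sum_add_distrib]
  simp only [hJd']

end AssocOper

section AssocOper

variable {X : Type u} [TopologicalSpace X] [ChartedSpace ℂ X] [IsManifold 𝓘(ℂ) ω X] {n : ℕ}
  {f h : Mat n} (𝓟 : GPOper.{u, v} X f h) {x : X}

namespace GPOper

/-- The symplectic form on the associated bundle. -/
noncomputable def assocForm (x : X) : 𝓟.AssocFibre x →ₗ[ℂ] 𝓟.AssocFibre x →ₗ[ℂ] ℂ :=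
  (Matrix.toLinearMap₂' ℂ (J (Fin n) ℂ)).compl₁₂ (𝓟.baseFrame x).symm.toLinearMap
    (𝓟.baseFrame x).symm.toLinearMap

theorem assocForm_assocFrame (p : 𝓟.P x) (v w : Std n) :
    𝓟.assocForm x (𝓟.assocFrame x p v) (𝓟.assocFrame x p w) = v ⬝ᵥ (J (Fin n) ℂ *ᵥ w) := by
  rw [← symplectic_form (fibreDiv (𝓟.basePoint x) p) v w]
  simp only [assocForm, assocFrame_apply, LinearMap.compl₁₂_apply, LinearEquiv.coe_coe,
    LinearEquiv.symm_apply_apply, Matrix.toLinearMap₂'_apply']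

theorem assocForm_eq (p : ∀ y, 𝓟.P y) (s t : ∀ y, 𝓟.AssocFibre y) (y : X) :
    𝓟.assocForm y (s y) (t y) = 𝓟.coord p s y ⬝ᵥ (J (Fin n) ℂ *ᵥ 𝓟.coord p t y) := by
  rw [← 𝓟.assocForm_assocFrame (p y), assocFrame_coord, assocFrame_coord]

theorem isSymplecticForm_assocForm : IsSymplecticForm n 𝓟.assocForm := by
  have hsep : ∀ x v, (∀ w, 𝓟.assocForm x v w = 0) → v = 0 := by
    intro x v hv
    obtain ⟨v, rfl⟩ := (𝓟.assocFrame x (𝓟.basePoint x)).surjective v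
    rw [eq_zero_of_dotProduct_J (v := v), map_zero]
    intro w
    rw [← 𝓟.assocForm_assocFrame (𝓟.basePoint x), hv]
  have halt : ∀ x, (𝓟.assocForm x).IsAlt := by
    intro x v
    obtain ⟨v, rfl⟩ := (𝓟.assocFrame x (𝓟.basePoint x)).surjective v
    rw [assocForm_assocFrame, dotProduct_J_mulVec]
    exact Finset.sum_eq_zero fun i _ => by ring
  refine ⟨halt, fun x => ⟨hsep x, fun w hw => hsep x w fun v => ?_⟩, fun s t x hs ht => ?_⟩
  · rw [← (halt x).neg, hw v, neg_zero]
  · have hp := 𝓟.holPSectionAt_localSection x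
    simp only [𝓟.assocForm_eq (𝓟.localSection x) s t, dotProduct, Matrix.mulVec]
    exact HolAt.sum fun i _ => ((holSectionAt_iff_coord' hp).1 hs i).mul
      (HolAt.sum fun j _ => (HolAt.const _).mul ((holSectionAt_iff_coord' hp).1 ht j))

/-- The Lagrangian subbundle of the associated bundle. -/
noncomputable def assocLagrangian (x : X) : Submodule ℂ (𝓟.AssocFibre x) :=
  (stdLagrangian n).map (𝓟.baseFrame x).toLinearMap

theorem map_assocFrame_eq_iff (hh : h = gradingElement n) (p : 𝓟.P x) :
    (stdLagrangian n).map (𝓟.assocFrame x p).toLinearMap = 𝓟.assocLagrangian x ↔ p ∈ 𝓟.Q x := by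
  have h1 : (stdLagrangian n).map (𝓟.assocFrame x p).toLinearMap =
      ((stdLagrangian n).map
        (symplecticEquiv (fibreDiv (𝓟.basePoint x) p)).toLinearMap).map
          (𝓟.baseFrame x).toLinearMap := by
    rw [← Submodule.map_comp]; rfl
  rw [h1, assocLagrangian, (Submodule.map_injective_of_injective (𝓟.baseFrame x).injective).eq_iff,
    map_stdLagrangian_eq_iff, ← hh,
    ← 𝓟.reduction.orbit x (𝓟.basePoint x) (𝓟.basePoint_mem x), smul_fibreDiv]

theorem assocFrame_mem_iff (hh : h = gradingElement n) {p : 𝓟.P x} (hp : p ∈ 𝓟.Q x) {v : Std n} :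
    𝓟.assocFrame x p v ∈ 𝓟.assocLagrangian x ↔ v ∈ stdLagrangian n := by
  rw [← (𝓟.map_assocFrame_eq_iff hh p).2 hp]
  exact (Submodule.mem_map_equiv _ (e := 𝓟.assocFrame x p)).trans (by
    rw [LinearEquiv.symm_apply_apply])

theorem isSubbundle_assocLagrangian (hh : h = gradingElement n) :
    IsSubbundle n n 𝓟.assocLagrangian := by
  intro x
  refine ⟨fun i y => 𝓟.assocFrame y (𝓟.localSection x y) (Pi.single (Sum.inl i) 1),
    fun i => holSectionAt_assocFrame (𝓟.holPSectionAt_localSection x) _, ?_⟩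
  filter_upwards [𝓟.localSection_mem x] with y hy
  constructor
  · exact linearIndependent_single_inl.map' (𝓟.assocFrame y _).toLinearMap
      (LinearEquiv.ker _)
  · rw [← (𝓟.map_assocFrame_eq_iff hh _).2 hy, ← span_single_inl, Submodule.map_span,
      ← Set.range_comp]
    rfl

/-- The connection on the associated bundle. -/
noncomputable def assocConn : CovariantDerivative 𝓘(ℂ) (Std n) 𝓟.AssocFibre where
  toFun s x := (assocDeriv (𝓟.localSection x) s x).toContinuousLinearMap
  isCovariantDerivativeOnUniv :=
    { add := by
        intro s t x hs ht _
        have hs' := mdifferentiableAt_iff_coord_localSection.1 hs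
        have ht' := mdifferentiableAt_iff_coord_localSection.1 ht
        refine ContinuousLinearMap.ext fun ξ => ?_
        have hc : 𝓟.coord (𝓟.localSection x) (s + t) =
            fun y => 𝓟.coord (𝓟.localSection x) s y + 𝓟.coord (𝓟.localSection x) t y :=
          funext fun y => map_add _ _ _
        change 𝓟.assocFrame x _ _ = 𝓟.assocFrame x _ _ + 𝓟.assocFrame x _ _
        rw [← map_add, hc, mulVec_add]
        congr 1
        have : (fun i => mvfderiv 𝓘(ℂ) (fun y => (𝓟.coord (𝓟.localSection x) s y +
            𝓟.coord (𝓟.localSection x) t y) i) x ξ) =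
            (fun i => mvfderiv 𝓘(ℂ) (fun y => 𝓟.coord (𝓟.localSection x) s y i) x ξ) +
            fun i => mvfderiv 𝓘(ℂ) (fun y => 𝓟.coord (𝓟.localSection x) t y i) x ξ := by
          funext i
          simp only [Pi.add_apply]
          rw [mvfderiv_fun_add (hs' i) (ht' i)]
          rfl
        rw [this]
        abel
      leibniz := by
        intro s φ x hs hφ _
        have hs' := mdifferentiableAt_iff_coord_localSection.1 hs
        refine ContinuousLinearMap.ext fun ξ => ?_
        have hc : 𝓟.coord (𝓟.localSection x) (φ • s) =
            fun y => φ y • 𝓟.coord (𝓟.localSection x) s y :=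
          funext fun y => (𝓟.assocFrame y (𝓟.localSection x y)).symm.map_smul (φ y) (s y)
        change 𝓟.assocFrame x _ _ = φ x • 𝓟.assocFrame x _ _ + mvfderiv 𝓘(ℂ) φ x ξ • s x
        conv_rhs => rw [← 𝓟.assocFrame_coord (𝓟.localSection x) s x]
        rw [← map_smul, ← map_smul, ← map_add, hc, mulVec_smul]
        congr 1
        have : (fun i => mvfderiv 𝓘(ℂ) (fun y => (φ y • 𝓟.coord (𝓟.localSection x) s y) i) x ξ) =
            (φ x • fun i => mvfderiv 𝓘(ℂ) (fun y => 𝓟.coord (𝓟.localSection x) s y i) x ξ) +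
            mvfderiv 𝓘(ℂ) φ x ξ • 𝓟.coord (𝓟.localSection x) s x := by
          funext i
          simp only [Pi.add_apply, Pi.smul_apply, smul_eq_mul]
          rw [mvfderiv_fun_mul hφ (hs' i)]
          simp
          ring
        rw [this]
        module }

theorem assocConn_apply {p : ∀ y, 𝓟.P y} (hp : HolPSectionAt n p x) {s : ∀ y, 𝓟.AssocFibre y}
    (hs : ∀ i, MDifferentiableAt 𝓘(ℂ) 𝓘(ℂ) (fun y => 𝓟.coord p s y i) x)
    (ξ : TangentSpace 𝓘(ℂ) x) :
    𝓟.assocConn s x ξ = 𝓟.assocFrame x (p x) (𝓟.conn.pullback p x ξ *ᵥ 𝓟.coord p s x +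
      fun i => mvfderiv 𝓘(ℂ) (fun y => 𝓟.coord p s y i) x ξ) :=
  congrArg (fun T : TangentSpace 𝓘(ℂ) x →ₗ[ℂ] 𝓟.AssocFibre x => T ξ)
    (assocDeriv_eq (𝓟.holPSectionAt_localSection x) hp hs)

theorem isHolConnection_assocConn : IsHolConnection n 𝓟.assocConn := by
  intro U hU
  refine ⟨fun {s} hs x hx => ContMDiffAt.contMDiffWithinAt ?_⟩
  have hs' : HolSectionAt n s x := (hs x hx).contMDiffAt (hU.mem_nhds hx)
  refine contMDiffAt_hom_of_holSectionAt fun V hV => ?_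
  have hp := 𝓟.holPSectionAt_localSection x
  have hc := (holSectionAt_iff_coord' hp).1 hs'
  rw [holSectionAt_iff_coord' hp]
  intro i
  have key : HolAt (fun y => (𝓟.conn.pullback (𝓟.localSection x) y (V y) *ᵥ
      𝓟.coord (𝓟.localSection x) s y) i +
      mvfderiv 𝓘(ℂ) (fun z => 𝓟.coord (𝓟.localSection x) s z i) y (V y)) x := by
    refine HolAt.add ?_ ((hc i).mvfderiv_apply hV)
    simp only [Matrix.mulVec, dotProduct]
    exact HolAt.sum fun j _ => (𝓟.conn.holomorphic _ x hp V hV i j).mul (hc j)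
  refine key.congr ?_
  filter_upwards [hp.eventually, Filter.eventually_all.2 fun i => (hc i).eventually] with y hy hcy
  rw [coord, 𝓟.assocConn_apply hy fun i => (hcy i).mdifferentiableAt,
    LinearEquiv.symm_apply_apply, Pi.add_apply]

theorem isCompatible_assocConn : IsCompatible n 𝓟.assocForm 𝓟.assocConn := by
  intro s t x hs ht ξ
  have hp := 𝓟.holPSectionAt_localSection x
  have hcs := fun i => ((holSectionAt_iff_coord' hp).1 hs i).mdifferentiableAt
  have hct := fun i => ((holSectionAt_iff_coord' hp).1 ht i).mdifferentiableAt
  simp only [𝓟.assocForm_eq (𝓟.localSection x) s t]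
  rw [mvfderiv_dotProduct_J hcs hct, 𝓟.assocConn_apply hp hcs, 𝓟.assocConn_apply hp hct]
  rw [← 𝓟.assocFrame_coord (𝓟.localSection x) s x, ← 𝓟.assocFrame_coord (𝓟.localSection x) t x,
    assocForm_assocFrame, assocForm_assocFrame]
  have := mem_spLie_iff_form.1 (𝓟.conn.mem_lie _ x hp ξ) (𝓟.coord (𝓟.localSection x) s x)
    (𝓟.coord (𝓟.localSection x) t x)
  rw [add_dotProduct, mulVec_add, dotProduct_add]
  linear_combination -this

/-- In the frame of a section `p` of the reduction, the second fundamental form is the lower left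
block of `p^*ω`, which the oper condition makes invertible. -/
theorem hasSecondFundamentalIso_assocConn {S : Matrix (Fin n) (Fin n) ℂ} (hS : Sᵀ = S)
    (hS0 : S.det ≠ 0) (hf : f = fromBlocks 0 0 S 0) (hh : h = gradingElement n) :
    HasSecondFundamentalIso n 𝓟.assocLagrangian 𝓟.assocConn := by
  intro x
  set p := 𝓟.localSection x with hpdef
  have hp : HolPSectionAt n p x := 𝓟.holPSectionAt_localSection x
  have hpQ : ∀ᶠ y in 𝓝 x, p y ∈ 𝓟.Q y := 𝓟.localSection_mem x
  set φ := 𝓟.assocFrame x (p x) with hφ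
  have hmem : ∀ v, φ v ∈ 𝓟.assocLagrangian x ↔ v ∈ stdLagrangian n := fun v =>
    𝓟.assocFrame_mem_iff hh hpQ.self_of_nhds
  have hmem' : ∀ w, w ∈ 𝓟.assocLagrangian x ↔ φ.symm w ∈ stdLagrangian n := fun w => by
    rw [← hmem, φ.apply_symm_apply]
  let T : 𝓟.assocLagrangian x →ₗ[ℂ]
      (TangentSpace 𝓘(ℂ) x →ₗ[ℂ] 𝓟.AssocFibre x ⧸ 𝓟.assocLagrangian x) :=
    LinearMap.mk₂ ℂ (fun v ξ => (𝓟.assocLagrangian x).mkQ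
        (φ (𝓟.conn.pullback p x ξ *ᵥ φ.symm v)))
      (fun v w ξ => by rw [← map_add, ← map_add, ← mulVec_add, ← map_add]; rfl)
      (fun c v ξ => by rw [← map_smul, ← map_smul, ← mulVec_smul, ← map_smul]; rfl)
      (fun v ξ η => by rw [← map_add, ← map_add, ← add_mulVec, ← map_add])
      (fun c v ξ => by rw [← map_smul, ← map_smul, ← smul_mulVec, ← map_smul])
  have hTinj : Function.Injective T := by
    rw [← LinearMap.ker_eq_bot, LinearMap.ker_eq_bot']
    intro v hv
    obtain ⟨ξ, hξ⟩ : ∃ ξ : TangentSpace 𝓘(ℂ) x, ξ ≠ 0 := ⟨(1 : ℂ), one_ne_zero (α := ℂ)⟩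
    have hdet : (𝓟.conn.pullback p x ξ).toBlocks₂₁.det ≠ 0 := by
      rw [← exists_mem_parabolic_iff hS hS0 (𝓟.conn.mem_lie p x hp ξ), ← hf, ← hh]
      exact 𝓟.oper p x hp hpQ ξ hξ
    have h1 : (𝓟.assocLagrangian x).mkQ (φ (𝓟.conn.pullback p x ξ *ᵥ φ.symm v)) = 0 :=
      congrArg (fun S : TangentSpace 𝓘(ℂ) x →ₗ[ℂ] _ => S ξ) hv
    rw [← LinearMap.mem_ker, Submodule.ker_mkQ, hmem] at h1
    have h2 := det_toBlocks₂₁_ne_zero_iff.1 hdet _ ((hmem' _).1 v.2) h1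
    exact Subtype.ext (φ.symm.map_eq_zero_iff.1 h2)
  have hfin : FiniteDimensional ℂ (𝓟.AssocFibre x) := φ.finiteDimensional
  have hrank : Module.finrank ℂ (𝓟.assocLagrangian x) = n := by
    rw [assocLagrangian, LinearEquiv.finrank_map_eq, finrank_stdLagrangian]
  have hrankT : Module.finrank ℂ (TangentSpace 𝓘(ℂ) x →ₗ[ℂ]
      𝓟.AssocFibre x ⧸ 𝓟.assocLagrangian x) = n := by
    have h1 : Module.finrank ℂ (TangentSpace 𝓘(ℂ) x) = 1 := Module.finrank_self ℂ
    have h2 := Submodule.finrank_quotient_add_finrank (𝓟.assocLagrangian x)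
    have h3 : Module.finrank ℂ (𝓟.AssocFibre x) = n + n := by
      rw [← φ.finrank_eq]; simp
    rw [Module.finrank_linearMap, h1]
    omega
  refine ⟨LinearEquiv.ofInjectiveOfFinrankEq T hTinj (hrank.trans hrankT.symm), ?_⟩
  intro s hs hsF ξ
  have hc := (holSectionAt_iff_coord' hp).1 hs
  change (𝓟.assocLagrangian x).mkQ (φ (𝓟.conn.pullback p x ξ *ᵥ φ.symm (s x))) = _
  rw [𝓟.assocConn_apply hp fun i => (hc i).mdifferentiableAt, map_add, map_add]
  refine (add_eq_left.2 ?_).symm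
  rw [← LinearMap.mem_ker, Submodule.ker_mkQ]
  refine (hmem _).2 (mem_stdLagrangian.2 fun i => ?_)
  -- the coordinates of `s` stay in the standard Lagrangian
  have : ∀ᶠ y in 𝓝 x, 𝓟.coord p s y (Sum.inr i) = 0 := by
    filter_upwards [hpQ, hsF] with y hy hsy
    rw [← 𝓟.assocFrame_coord p s y, 𝓟.assocFrame_mem_iff hh hy] at hsy
    exact mem_stdLagrangian.1 hsy i
  rw [mvfderiv_eq_zero_of_eventually_eq_zero this]
  rfl

/-- The generalized `B`-oper associated to a `(G, P)`-oper. -/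
noncomputable def assocOper {S : Matrix (Fin n) (Fin n) ℂ} (hS : Sᵀ = S) (hS0 : S.det ≠ 0)
    (hf : f = fromBlocks 0 0 S 0) (hh : h = gradingElement n) : BOper.{u, v} X n where
  E := 𝓟.AssocFibre
  B := 𝓟.assocForm
  symplectic := 𝓟.isSymplecticForm_assocForm
  F₁ := 𝓟.assocLagrangian
  subbundle := 𝓟.isSubbundle_assocLagrangian hh
  orthogonal x w := by
    have hb : 𝓟.basePoint x ∈ 𝓟.Q x := 𝓟.basePoint_mem x
    obtain ⟨w, rfl⟩ := (𝓟.assocFrame x (𝓟.basePoint x)).surjective w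
    rw [𝓟.assocFrame_mem_iff hh hb, mem_stdLagrangian_iff_orthogonal,
      ← (𝓟.map_assocFrame_eq_iff hh _).2 hb]
    simp only [Submodule.mem_map, forall_exists_index, and_imp, forall_apply_eq_imp_iff₂,
      LinearEquiv.coe_coe, assocForm_assocFrame]
  D := 𝓟.assocConn
  holConnection := 𝓟.isHolConnection_assocConn
  compatible := 𝓟.isCompatible_assocConn
  nondegenerate := 𝓟.hasSecondFundamentalIso_assocConn hS hS0 hf hh

/-- The oper and its associated bundle. -/
noncomputable def association {S : Matrix (Fin n) (Fin n) ℂ} (hS : Sᵀ = S) (hS0 : S.det ≠ 0)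
    (hf : f = fromBlocks 0 0 S 0) (hh : h = gradingElement n) :
    Association 𝓟 (𝓟.assocOper hS hS0 hf hh) where
  frame := 𝓟.assocFrame
  equivariant := 𝓟.assocFrame_smul
  holomorphic _ _ hs v := holSectionAt_assocFrame hs v
  form _ p v w := 𝓟.assocForm_assocFrame p v w
  filtration _ p := (𝓟.map_assocFrame_eq_iff hh p).symm
  conn s x hs v ξ := by
    have hc : 𝓟.coord s (fun y => 𝓟.assocFrame y (s y) v) = fun _ => v :=
      funext fun y => LinearEquiv.symm_apply_apply _ _
    have := 𝓟.assocConn_apply hs (s := fun y => 𝓟.assocFrame y (s y) v)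
      (fun i => by rw [hc]; exact mdifferentiableAt_const) ξ
    refine this.trans ?_
    rw [hc]
    congr 1
    rw [add_eq_left]
    funext i
    rw [mvfderiv_const]
    rfl

end GPOper

end AssocOper

/-! ### Adapted symplectic frames -/

section Linear

variable {n : ℕ} {W : Type v} [AddCommGroup W] [Module ℂ W] {B : W →ₗ[ℂ] W →ₗ[ℂ] ℂ}

/-- Vectors whose Gram matrix is `J` form a symplectic frame. -/
theorem exists_symplecticFrame_of_gram [FiniteDimensional ℂ W]
    (hW : Module.finrank ℂ W = n + n) {b : Fin n ⊕ Fin n → W}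
    (hb : ∀ a c, B (b a) (b c) = J (Fin n) ℂ a c) :
    ∃ φ : SymplecticFrame n B, ∀ v, φ.1 v = ∑ a, v a • b a := by
  let L : Std n →ₗ[ℂ] W := Fintype.linearCombination ℂ b
  have hL : ∀ v, L v = ∑ a, v a • b a := fun v => Fintype.linearCombination_apply ℂ b v
  have hform : ∀ v w, B (L v) (L w) = v ⬝ᵥ (J (Fin n) ℂ *ᵥ w) := by
    intro v w
    have hrow : ∀ a, B (b a) (L w) = (J (Fin n) ℂ *ᵥ w) a := by
      intro a
      rw [hL, map_sum]
      refine Finset.sum_congr rfl fun c _ => ?_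
      rw [map_smul, hb, smul_eq_mul, mul_comm]
    rw [hL v, map_sum, LinearMap.sum_apply]
    refine Finset.sum_congr rfl fun a _ => ?_
    rw [map_smul, LinearMap.smul_apply, hrow, smul_eq_mul]
  have hinj : Function.Injective L := by
    rw [← LinearMap.ker_eq_bot, LinearMap.ker_eq_bot']
    intro v hv
    refine eq_zero_of_dotProduct_J fun w => ?_
    rw [← hform, hv, map_zero, LinearMap.zero_apply]
  have hrank : Module.finrank ℂ (Std n) = Module.finrank ℂ W := by rw [hW]; simp
  exact ⟨⟨LinearEquiv.ofInjectiveOfFinrankEq L hinj hrank, hform⟩, hL⟩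

/-- A linearly independent family has a dual family with respect to a nondegenerate form. -/
theorem exists_dual_family [FiniteDimensional ℂ W] (hB : B.Nondegenerate) {s : Fin n → W}
    (hs : LinearIndependent ℂ s) :
    ∃ u : Fin n → W, ∀ i j, B (s i) (u j) = -(1 : Matrix (Fin n) (Fin n) ℂ) i j := by
  have hsurj : Function.Surjective B.flip := by
    have hinj : Function.Injective B.flip := by
      rw [← LinearMap.ker_eq_bot, LinearMap.ker_eq_bot']
      intro v hv
      exact hB.2 v fun w => congrArg (fun T : W →ₗ[ℂ] ℂ => T w) hv
    exact (LinearMap.injective_iff_surjective_of_finrank_eq_finrank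
      Subspace.dual_finrank_eq.symm).1 hinj
  have hl : ∀ j, ∃ l : W →ₗ[ℂ] ℂ, ∀ i, l (s i) = -(1 : Matrix (Fin n) (Fin n) ℂ) i j := by
    intro j
    obtain ⟨l, hl⟩ := LinearMap.exists_extend (-(Module.Basis.span hs).coord j)
    refine ⟨l, fun i => ?_⟩
    have h1 : l (Module.Basis.span hs i) =
        -(Module.Basis.span hs).repr (Module.Basis.span hs i) j :=
      congrArg (fun T : Submodule.span ℂ (Set.range s) →ₗ[ℂ] ℂ => T (Module.Basis.span hs i)) hl
    rwa [Module.Basis.repr_self, Finsupp.single_apply, Module.Basis.span_apply,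
      ← Matrix.one_apply] at h1
  choose l hl using hl
  choose u hu using fun j => hsurj (l j)
  refine ⟨u, fun i j => ?_⟩
  rw [← hl j i, ← hu j, LinearMap.flip_apply]

/-- The symplectic Gram-Schmidt step: a family dual to an isotropic one becomes isotropic after
adding a combination of the isotropic one. -/
theorem gram_sumElim (hB : B.IsAlt) {s u : Fin n → W} (hs : ∀ i j, B (s i) (s j) = 0)
    (hsu : ∀ i j, B (s i) (u j) = -(1 : Matrix (Fin n) (Fin n) ℂ) i j) (a c : Fin n ⊕ Fin n) :
    B (Sum.elim s (fun j => u j + ∑ k, (-(1 / 2) * B (u k) (u j)) • s k) a)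
      (Sum.elim s (fun j => u j + ∑ k, (-(1 / 2) * B (u k) (u j)) • s k) c) =
      J (Fin n) ℂ a c := by
  have hus : ∀ i j, B (u i) (s j) = (1 : Matrix (Fin n) (Fin n) ℂ) i j := by
    intro i j
    rw [← hB.neg, hsu, neg_neg]
    simp only [Matrix.one_apply, eq_comm]
  rcases a with i | i <;> rcases c with j | j
  · simp [J, hs]
  · simp [J, hs, hsu]
  · simp [J, hs, hus]
  · have h : B (u j) (u i) = -B (u i) (u j) := (hB.neg _ _).symm
    simp [J, hs, hus, hsu, Matrix.one_apply]
    rw [h]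
    ring

end Linear

namespace BOper

variable {X : Type u} [TopologicalSpace X] [ChartedSpace ℂ X] [IsManifold 𝓘(ℂ) ω X] {n : ℕ}
  (𝓔 : BOper.{u, v} X n) {x : X}

theorem finiteDimensional (x : X) : FiniteDimensional ℂ (𝓔.E x) :=
  ((trivializationAt (Std n) 𝓔.E x).linearEquivAt ℂ x
    (mem_baseSet_trivializationAt _ _ _)).symm.finiteDimensional

theorem finrank (x : X) : Module.finrank ℂ (𝓔.E x) = n + n := by
  rw [((trivializationAt (Std n) 𝓔.E x).linearEquivAt ℂ x
    (mem_baseSet_trivializationAt _ _ _)).finrank_eq]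
  simp

/-- Around each point there are holomorphic vectors that form a symplectic basis, the first half
of which spans `F₁`. -/
theorem exists_adapted_basis (x : X) :
    ∃ b : Fin n ⊕ Fin n → ∀ y, 𝓔.E y, (∀ a, HolSectionAt n (b a) x) ∧
      ∀ᶠ y in 𝓝 x, (∀ a c, 𝓔.B y (b a y) (b c y) = J (Fin n) ℂ a c) ∧
        Submodule.span ℂ (Set.range fun i => b (Sum.inl i) y) = 𝓔.F₁ y := by
  obtain ⟨s, hs, hsF⟩ := 𝓔.subbundle x
  have := 𝓔.finiteDimensional x
  obtain ⟨w, hw⟩ := exists_dual_family (𝓔.symplectic.nondegenerate x) hsF.self_of_nhds.1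
  choose u hu hux using fun j => exists_holSectionAt (n := n) (w j)
  -- the pairing of `s` with the extensions of the dual family, invertible near `x`
  let M : X → Matrix (Fin n) (Fin n) ℂ := fun y => Matrix.of fun i j => -𝓔.B y (s i y) (u j y)
  have hM : ∀ i j, HolAt (fun y => M y i j) x := fun i j =>
    (𝓔.symplectic.holomorphic _ _ x (hs i) (hu j)).neg
  have hMx : M x = 1 := by
    ext i j
    simp only [M, Matrix.of_apply, hux, hw, neg_neg]
  have hdet : (M x).det ≠ 0 := by rw [hMx, det_one]; exact one_ne_zero
  have hdet' : ∀ᶠ y in 𝓝 x, (M y).det ≠ 0 :=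
    (HolAt.det hM).continuousAt.eventually_ne hdet
  let u' : Fin n → ∀ y, 𝓔.E y := fun j y => ∑ k, (M y)⁻¹ k j • u k y
  have hu' : ∀ j, HolSectionAt n (u' j) x := fun j =>
    HolSectionAt.sum fun k => HolSectionAt.smul (HolAt.matrix_inv hM hdet k j) (hu k)
  refine ⟨fun a y => Sum.elim (fun i => s i y)
    (fun j => u' j y + ∑ k, (-(1 / 2) * 𝓔.B y (u' k y) (u' j y)) • s k y) a, ?_, ?_⟩
  · rintro (i | j)
    · exact hs i
    · exact (hu' j).add (HolSectionAt.sum fun k => HolSectionAt.smul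
        ((HolAt.const _).mul (𝓔.symplectic.holomorphic _ _ x (hu' k) (hu' j))) (hs k))
  · filter_upwards [hsF, hdet'] with y hy hMy
    refine ⟨gram_sumElim (𝓔.symplectic.alt y) (fun i j => ?_) fun i j => ?_, hy.2⟩
    · have hmem : ∀ i, s i y ∈ 𝓔.F₁ y := fun i => by
        rw [← hy.2]; exact Submodule.subset_span ⟨i, rfl⟩
      exact (𝓔.orthogonal y _).1 (hmem i) _ (hmem j)
    · have h1 := congrFun (congrFun (Matrix.mul_nonsing_inv (M y) hMy.isUnit) i) j
      rw [← h1, Matrix.mul_apply]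
      simp only [u', map_sum, map_smul, smul_eq_mul, M, Matrix.of_apply]
      rw [← Finset.sum_neg_distrib]
      exact Finset.sum_congr rfl fun k _ => by ring

theorem exists_frame_of_gram {y : X} {b : Fin n ⊕ Fin n → 𝓔.E y}
    (hb : ∀ a c, 𝓔.B y (b a) (b c) = J (Fin n) ℂ a c) :
    ∃ φ : SymplecticFrame n (𝓔.B y), ∀ v, φ.1 v = ∑ a, v a • b a :=
  have := 𝓔.finiteDimensional y
  exists_symplecticFrame_of_gram (𝓔.finrank y) hb

theorem nonempty_symplecticFrame (x : X) : Nonempty (SymplecticFrame n (𝓔.B x)) :=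
  let ⟨_, _, hb⟩ := 𝓔.exists_adapted_basis x
  let ⟨φ, _⟩ := 𝓔.exists_frame_of_gram hb.self_of_nhds.1
  ⟨φ⟩

/-- A symplectic frame is adapted if it takes `ℂⁿ ⊕ 0` to `F₁`. -/
def IsAdapted (φ : SymplecticFrame n (𝓔.B x)) : Prop :=
  (stdLagrangian n).map φ.1.toLinearMap = 𝓔.F₁ x

/-- The frames built from a local symplectic basis, completed by arbitrary symplectic frames far
from `x`. -/
theorem exists_adaptedFrame (x : X) : ∃ φ : ∀ y, SymplecticFrame n (𝓔.B y),
    (∀ v, HolSectionAt n (fun y => (φ y).1 v) x) ∧ ∀ᶠ y in 𝓝 x, 𝓔.IsAdapted (φ y) := by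
  classical
  obtain ⟨b, hb, hbB⟩ := 𝓔.exists_adapted_basis x
  have hφ : ∀ y, ∃ φ : SymplecticFrame n (𝓔.B y),
      (∀ a c, 𝓔.B y (b a y) (b c y) = J (Fin n) ℂ a c) → ∀ v, φ.1 v = ∑ a, v a • b a y := by
    intro y
    by_cases h : ∀ a c, 𝓔.B y (b a y) (b c y) = J (Fin n) ℂ a c
    · obtain ⟨φ, hφ⟩ := 𝓔.exists_frame_of_gram h
      exact ⟨φ, fun _ => hφ⟩
    · obtain ⟨φ⟩ := 𝓔.nonempty_symplecticFrame y
      exact ⟨φ, fun h' => absurd h' h⟩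
  choose φ hφ using hφ
  refine ⟨φ, fun v => ?_, ?_⟩
  · refine (HolSectionAt.sum (a := Finset.univ) fun a =>
      HolSectionAt.smul (HolAt.const (v a)) (hb a)).congr ?_
    filter_upwards [hbB] with y hy
    exact hφ y hy.1 v
  · filter_upwards [hbB] with y hy
    rw [IsAdapted, ← span_single_inl, Submodule.map_span, ← Set.range_comp, ← hy.2]
    congr 2
    funext i
    simp [hφ y hy.1, Pi.single_apply]

theorem eventually_holSectionAt {φ : ∀ y, SymplecticFrame n (𝓔.B y)}
    (hφ : ∀ v, HolSectionAt n (fun y => (φ y).1 v) x) :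
    ∀ᶠ z in 𝓝 x, ∀ v, HolSectionAt n (fun y => (φ y).1 v) z := by
  filter_upwards [Filter.eventually_all.2 fun a => (hφ (Pi.single a 1)).eventually] with z hz v
  refine (HolSectionAt.sum (a := Finset.univ) fun a =>
    HolSectionAt.smul (HolAt.const (v a)) (hz a)).congr (Filter.Eventually.of_forall fun y => ?_)
  simpa using linearEquiv_apply_eq_sum (φ y).1 ((φ y).1 v)

theorem holGroupAt_div_iff {φ ψ : ∀ y, SymplecticFrame n (𝓔.B y)}
    (hφ : ∀ v, HolSectionAt n (fun y => (φ y).1 v) x) :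
    HolGroupAt (fun y => (φ y).div (ψ y)) x ↔ ∀ v, HolSectionAt n (fun y => (ψ y).1 v) x := by
  rw [holGroupAt_iff_mulVec]
  refine forall_congr' fun v => ?_
  rw [holSectionAt_iff_coord 𝓔.symplectic hφ fun y => (φ y).2]
  simp only [SymplecticFrame.div_mulVec]

/-! ### The bundle of symplectic frames -/

/-- The adapted symplectic frames around `x` used as a trivialization. -/
noncomputable def localFrame (x : X) : ∀ y, SymplecticFrame n (𝓔.B y) :=
  (𝓔.exists_adaptedFrame x).choose

theorem holSectionAt_localFrame (x : X) (v : Std n) :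
    HolSectionAt n (fun y => (𝓔.localFrame x y).1 v) x :=
  (𝓔.exists_adaptedFrame x).choose_spec.1 v

theorem isAdapted_localFrame (x : X) : ∀ᶠ y in 𝓝 x, 𝓔.IsAdapted (𝓔.localFrame x y) :=
  (𝓔.exists_adaptedFrame x).choose_spec.2

/-- An open neighbourhood of `x` on which the local frame at `x` is holomorphic. -/
def localDomain (x : X) : Set X :=
  interior {z | ∀ v, HolSectionAt n (fun y => (𝓔.localFrame x y).1 v) z}

theorem mem_localDomain (x : X) : x ∈ 𝓔.localDomain x :=
  mem_interior_iff_mem_nhds.2 (𝓔.eventually_holSectionAt (𝓔.holSectionAt_localFrame x))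

/-- The bundle of symplectic frames of `(E, B)`. -/
def FrameBundle (x : X) : Type v := SymplecticFrame n (𝓔.B x)

instance (x : X) : MulAction (SpC n)ᵐᵒᵖ (𝓔.FrameBundle x) :=
  inferInstanceAs (MulAction (SpC n)ᵐᵒᵖ (SymplecticFrame n (𝓔.B x)))

noncomputable instance (x : X) : TopologicalSpace (𝓔.FrameBundle x) :=
  TopologicalSpace.induced (fun φ => (𝓔.localFrame x x).div φ) inferInstance

/-- The pretrivialization of the frame bundle given by a local frame. -/
noncomputable def framePretriv (x : X) :
    Pretrivialization (SpC n) (π (SpC n) 𝓔.FrameBundle) where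
  toFun z := (z.proj, (𝓔.localFrame x z.proj).div z.2)
  invFun z := ⟨z.1, 𝓔.localFrame x z.1 <• z.2⟩
  source := π (SpC n) 𝓔.FrameBundle ⁻¹' 𝓔.localDomain x
  target := 𝓔.localDomain x ×ˢ Set.univ
  map_source' _ hz := ⟨hz, trivial⟩
  map_target' _ hz := hz.1
  left_inv' z _ := congrArg (TotalSpace.mk z.proj) (SymplecticFrame.smul_div _ _)
  right_inv' _ _ := Prod.ext rfl (SymplecticFrame.div_smul_self _ _)
  open_target := isOpen_interior.prod isOpen_univ
  baseSet := 𝓔.localDomain x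
  open_baseSet := isOpen_interior
  source_eq := rfl
  target_eq := rfl
  proj_toFun _ _ := rfl

theorem holGroupAt_change {x x' y : X} (hy : y ∈ 𝓔.localDomain x) (hy' : y ∈ 𝓔.localDomain x') :
    HolGroupAt (fun z => (𝓔.localFrame x' z).div (𝓔.localFrame x z)) y :=
  (𝓔.holGroupAt_div_iff (interior_subset hy')).2 (interior_subset hy)

/-- The fibre bundle structure of the bundle of symplectic frames. -/
noncomputable def framePrebundle : FiberPrebundle (SpC n) 𝓔.FrameBundle where
  pretrivializationAtlas := Set.range 𝓔.framePretriv
  pretrivializationAt := 𝓔.framePretriv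
  mem_base_pretrivializationAt := 𝓔.mem_localDomain
  pretrivialization_mem_atlas x := ⟨x, rfl⟩
  continuous_trivChange := by
    rintro _ ⟨x', rfl⟩ _ ⟨x, rfl⟩
    have h : ∀ z : X × SpC n, (𝓔.framePretriv x' ∘ (𝓔.framePretriv x).toPartialEquiv.symm) z =
        (z.1, (𝓔.localFrame x' z.1).div (𝓔.localFrame x z.1) * z.2) := fun z =>
      Prod.ext rfl (SymplecticFrame.div_smul _ _ _)
    rintro ⟨y, g⟩ ⟨hy, hy'⟩
    refine ContinuousAt.continuousWithinAt ?_
    rw [show (𝓔.framePretriv x' ∘ (𝓔.framePretriv x).toPartialEquiv.symm) = _ from funext h]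
    exact continuousAt_fst.prodMk (((𝓔.holGroupAt_change hy.1 hy').continuousAt.comp
      (f := Prod.fst) (x := (y, g)) continuousAt_fst).mul continuousAt_snd)
  totalSpaceMk_isInducing x := Topology.isInducing_const_prod.2 ⟨rfl⟩

noncomputable instance : TopologicalSpace (TotalSpace (SpC n) 𝓔.FrameBundle) :=
  𝓔.framePrebundle.totalSpaceTopology

noncomputable instance : FiberBundle (SpC n) 𝓔.FrameBundle :=
  𝓔.framePrebundle.toFiberBundle

instance : IsHolPrincipalBundle n 𝓔.FrameBundle where
  equivariant := by
    rintro _ ⟨_, ⟨x', rfl⟩, rfl⟩ x _ p g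
    exact SymplecticFrame.div_smul (𝓔.localFrame x' x) p g
  holomorphic := by
    rintro _ ⟨_, ⟨x, rfl⟩, rfl⟩ _ ⟨_, ⟨x', rfl⟩, rfl⟩ y ⟨hy, hy'⟩
    refine (𝓔.holGroupAt_change (x := x) (x' := x') hy hy').congr
      (Filter.Eventually.of_forall fun z => ?_)
    change (𝓔.localFrame x' z).div (𝓔.localFrame x z <• (1 : SpC n)) = _
    rw [SymplecticFrame.div_smul, mul_one]

theorem holPSectionAt_frameBundle_iff {s : ∀ y, 𝓔.FrameBundle y} :
    HolPSectionAt n s x ↔ ∀ v, HolSectionAt n (fun y => (s y).1 v) x :=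
  𝓔.holGroupAt_div_iff (𝓔.holSectionAt_localFrame x)

/-! ### The connection on the bundle of symplectic frames -/

/-- The connection matrix of `D` in the frame `s`. -/
noncomputable def connMatrix (s : ∀ y, 𝓔.FrameBundle y) (x : X) :
    TangentSpace 𝓘(ℂ) x →ₗ[ℂ] Mat n where
  toFun ξ := Matrix.of fun i j =>
    (s x).1.symm (𝓔.D (fun y => (s y).1 (Pi.single j 1)) x ξ) i
  map_add' ξ η := by
    ext i j
    simp only [map_add, Matrix.of_apply, Matrix.add_apply, Pi.add_apply]
  map_smul' c ξ := by
    ext i j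
    simp only [map_smul, Matrix.of_apply, Matrix.smul_apply, Pi.smul_apply, RingHom.id_apply]

theorem apply_connMatrix_mulVec (s : ∀ y, 𝓔.FrameBundle y) (ξ : TangentSpace 𝓘(ℂ) x) (v : Std n) :
    (s x).1 (𝓔.connMatrix s x ξ *ᵥ v) =
      ∑ a, v a • 𝓔.D (fun y => (s y).1 (Pi.single a 1)) x ξ := by
  rw [← LinearEquiv.eq_symm_apply, map_sum]
  ext i
  simp only [Matrix.mulVec, dotProduct, connMatrix, LinearMap.coe_mk, AddHom.coe_mk,
    Matrix.of_apply, map_smul, Finset.sum_apply, Pi.smul_apply, smul_eq_mul]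
  exact Finset.sum_congr rfl fun a _ => mul_comm _ _

variable {𝓔} in
theorem conn_apply_frame {s : ∀ y, 𝓔.FrameBundle y}
    (hs : ∀ v, HolSectionAt n (fun y => (s y).1 v) x) {c : X → Std n}
    (hc : ∀ i, MDifferentiableAt 𝓘(ℂ) 𝓘(ℂ) (fun y => c y i) x) (ξ : TangentSpace 𝓘(ℂ) x) :
    𝓔.D (fun y => (s y).1 (c y)) x ξ = (s x).1 (𝓔.connMatrix s x ξ *ᵥ c x +
      fun i => mvfderiv 𝓘(ℂ) (fun y => c y i) x ξ) := by
  have h := covariantDerivative_frame 𝓔.D (φ := fun y => (s y).1) hs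
    (s := fun y => (s y).1 (c y)) (by simpa only [LinearEquiv.symm_apply_apply] using hc) ξ
  rw [h, map_add, apply_connMatrix_mulVec]
  simp only [LinearEquiv.symm_apply_apply]

variable {𝓔} in
theorem conn_apply_frame_const {s : ∀ y, 𝓔.FrameBundle y}
    (hs : ∀ v, HolSectionAt n (fun y => (s y).1 v) x) (v : Std n) (ξ : TangentSpace 𝓘(ℂ) x) :
    𝓔.D (fun y => (s y).1 v) x ξ = (s x).1 (𝓔.connMatrix s x ξ *ᵥ v) := by
  rw [conn_apply_frame hs (c := fun _ => v) (fun i => mdifferentiableAt_const) ξ]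
  congr 1
  rw [add_eq_left]
  funext i
  rw [mvfderiv_const]
  rfl

theorem holSectionAt_conn_apply {s : ∀ y, 𝓔.E y} (hs : HolSectionAt n s x)
    {V : ∀ y : X, TangentSpace 𝓘(ℂ) y} (hV : HolVectorFieldAt V x) :
    HolSectionAt n (fun y => 𝓔.D s y (V y)) x := by
  obtain ⟨t, ht, hst⟩ := (contMDiffAt_iff_contMDiffOn_nhds (n := ω) (by simp)).1 hs
  obtain ⟨U, hUt, hU, hxU⟩ := mem_nhds_iff.1 ht
  have h := ((𝓔.holConnection U hU).contMDiff (hst.mono hUt)).contMDiffAt (hU.mem_nhds hxU)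
  exact h.clm_bundle_apply hV

/-- The principal connection on the bundle of symplectic frames. -/
noncomputable def frameConn : PrincipalConnection n 𝓔.FrameBundle where
  pullback := 𝓔.connMatrix
  mem_lie s x hs ξ := by
    rw [𝓔.holPSectionAt_frameBundle_iff] at hs
    rw [mem_spLie_iff_form]
    intro v w
    have h := 𝓔.compatible _ _ x (hs v) (hs w) ξ
    rw [conn_apply_frame_const hs, conn_apply_frame_const hs, (s x).2, (s x).2] at h
    rw [← h]
    simp only [(s _).2]
    rw [mvfderiv_const]
    rfl
  holomorphic s x hs V hV i j := by
    rw [𝓔.holPSectionAt_frameBundle_iff] at hs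
    exact (holSectionAt_iff_coord 𝓔.symplectic hs fun y => (s y).2).1
      (𝓔.holSectionAt_conn_apply (hs (Pi.single j 1)) hV) i
  gauge s x hs g hg ξ := by
    have hsg := (hs.smul hg)
    rw [𝓔.holPSectionAt_frameBundle_iff] at hs hsg
    have key : ∀ v : Std n, 𝓔.connMatrix (fun y => s y <• g y) x ξ *ᵥ v =
        (Ad (g x)⁻¹ (𝓔.connMatrix s x ξ) +
          (((g x)⁻¹ : SpC n) : Mat n) * dGroup g x ξ) *ᵥ v := by
      intro v
      have h1 := conn_apply_frame_const hsg v ξ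
      have hgv : ∀ i, MDifferentiableAt 𝓘(ℂ) 𝓘(ℂ) (fun y => ((g y : Mat n) *ᵥ v) i) x := fun i =>
        (hg.mulVec (c := fun _ => v) (fun i => HolAt.const (v i)) i).mdifferentiableAt
      have h2 := conn_apply_frame hs hgv ξ
      have hd : (fun i => mvfderiv 𝓘(ℂ) (fun y => ((g y : Mat n) *ᵥ v) i) x ξ) =
          dGroup g x ξ *ᵥ v := by
        funext i
        rw [dGroup_mulVec hg ξ (c := fun _ => v) (fun i => mdifferentiableAt_const) i]
        simp only [mvfderiv_const]
        rw [add_eq_left]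
        exact congrFun (mulVec_zero (g x : Mat n)) i
      rw [hd] at h2
      have h3 : (g x : Mat n) *ᵥ (𝓔.connMatrix (fun y => s y <• g y) x ξ *ᵥ v) =
          𝓔.connMatrix s x ξ *ᵥ ((g x : Mat n) *ᵥ v) + dGroup g x ξ *ᵥ v :=
        (s x).1.injective (h1.symm.trans h2)
      rw [← symplectic_inv_mulVec_mulVec (g x) (𝓔.connMatrix _ x ξ *ᵥ v), h3, mulVec_add,
        add_mulVec]
      simp only [Ad, inv_inv, ← mulVec_mulVec]
    exact Matrix.ext fun i j => by simpa using congrFun (key (Pi.single j 1)) i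

theorem isAdapted_smul_iff {φ : SymplecticFrame n (𝓔.B x)} (hφ : 𝓔.IsAdapted φ) (g : SpC n) :
    𝓔.IsAdapted (φ <• g) ↔ g ∈ parabolic (gradingElement n) := by
  rw [← map_stdLagrangian_eq_iff, IsAdapted, ← hφ,
    ← (Submodule.map_injective_of_injective φ.1.injective).eq_iff, ← Submodule.map_comp]
  rfl

/-- The `(G, P)`-oper of symplectic frames, reduced to the adapted ones. -/
noncomputable def frameOper {f h : Mat n} {S : Matrix (Fin n) (Fin n) ℂ} (hS : Sᵀ = S)
    (hS0 : S.det ≠ 0) (hf : f = fromBlocks 0 0 S 0) (hh : h = gradingElement n) :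
    GPOper.{u, v} X f h where
  P := 𝓔.FrameBundle
  Q x := {φ | 𝓔.IsAdapted φ}
  reduction :=
    { orbit := fun x p hp g => by
        rw [hh]
        exact 𝓔.isAdapted_smul_iff hp g
      exists_section := fun x => ⟨𝓔.localFrame x,
        𝓔.holPSectionAt_frameBundle_iff.2 (𝓔.holSectionAt_localFrame x),
        𝓔.isAdapted_localFrame x⟩ }
  conn := 𝓔.frameConn
  oper s x hs hsQ ξ hξ := by
    -- the second fundamental form, which is injective, is the lower left block of the connection
    -- matrix in an adapted frame
    have hlie := 𝓔.frameConn.mem_lie s x hs ξ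
    rw [hf, hh, exists_mem_parabolic_iff hS hS0 hlie, det_toBlocks₂₁_ne_zero_iff]
    intro v hv hAv
    rw [𝓔.holPSectionAt_frameBundle_iff] at hs
    have hmem : ∀ y, 𝓔.IsAdapted (s y) → ∀ w ∈ stdLagrangian n, (s y).1 w ∈ 𝓔.F₁ y := by
      intro y hy w hw
      rw [← hy]
      exact ⟨w, hw, rfl⟩
    obtain ⟨T, hT⟩ := 𝓔.nondegenerate x
    have hsv : ∀ᶠ y in 𝓝 x, (s y).1 v ∈ 𝓔.F₁ y := hsQ.mono fun y hy => hmem y hy v hv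
    have h1 := hT _ (hs v) hsv ξ
    rw [conn_apply_frame_const hs v ξ] at h1
    have h2 : (𝓔.F₁ x).mkQ ((s x).1 (𝓔.connMatrix s x ξ *ᵥ v)) = 0 := by
      rw [← LinearMap.mem_ker, Submodule.ker_mkQ]
      exact hmem x hsQ.self_of_nhds _ hAv
    rw [h2] at h1
    -- `ξ` spans the tangent line
    have h3 : T ⟨(s x).1 v, hsv.self_of_nhds⟩ = 0 := by
      refine LinearMap.ext fun η => ?_
      obtain ⟨c, hc⟩ : ∃ c : ℂ, c • ξ = η :=
        exists_smul_eq_of_finrank_eq_one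
          (Module.finrank_self ℂ : Module.finrank ℂ (TangentSpace 𝓘(ℂ) x) = 1) hξ η
      rw [← hc, map_smul, h1, smul_zero, LinearMap.zero_apply]
    have h4 := congrArg Subtype.val (T.map_eq_zero_iff.1 h3)
    exact (s x).1.map_eq_zero_iff.1 h4

/-- A `B`-oper is associated to the oper of its symplectic frames. -/
noncomputable def association {f h : Mat n} {S : Matrix (Fin n) (Fin n) ℂ} (hS : Sᵀ = S)
    (hS0 : S.det ≠ 0) (hf : f = fromBlocks 0 0 S 0) (hh : h = gradingElement n) :
    Association (𝓔.frameOper hS hS0 hf hh) 𝓔 where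
  frame _ p := p.1
  equivariant _ _ _ _ := rfl
  holomorphic _ _ hs := 𝓔.holPSectionAt_frameBundle_iff.1 hs
  form _ p := p.2
  filtration _ _ := Iff.rfl
  conn _ _ hs v ξ := conn_apply_frame_const (𝓔.holPSectionAt_frameBundle_iff.1 hs) v ξ

end BOper

end Opers

theorem proposition4p5 {X : Type u} [TopologicalSpace X] [ChartedSpace ℂ X]
    [IsManifold 𝓘(ℂ) ω X] (n : ℕ) (hn : 1 ≤ n)
    (f h e : Opers.RMat n) (triple : Opers.IsThetaPrincipalTriple f h e) :
    ∃ (Φ : Opers.ThetaPositiveOper.{u, v} X triple ≌ Opers.BOper.{u, v} X n)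
      (α : ∀ 𝓟 : Opers.ThetaPositiveOper.{u, v} X triple,
        Opers.Association 𝓟 (Φ.functor.obj 𝓟)),
      ∀ (𝓟 𝓠 : Opers.ThetaPositiveOper.{u, v} X triple) (m : 𝓟 ⟶ 𝓠)
        (x : X) (p : 𝓟.P x) (w : Opers.Std n),
        (Φ.functor.map m).toEquiv x ((α 𝓟).frame x p w) =
          (α 𝓠).frame x (m.toEquiv x p) w := by
  obtain ⟨S, hS, hS0, hf, hh⟩ := triple.exists_block
  let α : ∀ 𝓟 : Opers.ThetaPositiveOper.{u, v} X triple, Opers.Association 𝓟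
      (𝓟.assocOper hS hS0 hf hh) := fun 𝓟 => 𝓟.association hS hS0 hf hh
  choose map hmap using fun (𝓟 𝓠 : Opers.ThetaPositiveOper.{u, v} X triple) (m : 𝓟 ⟶ 𝓠) =>
    (α 𝓟).exists_map (α 𝓠) m
  let F : Opers.ThetaPositiveOper.{u, v} X triple ⥤ Opers.BOper.{u, v} X n :=
    { obj := fun 𝓟 => 𝓟.assocOper hS hS0 hf hh
      map := fun {𝓟 𝓠} m => map 𝓟 𝓠 m
      map_id := fun 𝓟 => (α 𝓟).map_unique fun x p w => hmap 𝓟 𝓟 (𝟙 𝓟) x p w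
      map_comp := fun {𝓟 𝓠 𝓢} m k => (α 𝓟).map_unique fun x p w => by
        rw [hmap 𝓟 𝓢 (m ≫ k)]
        change _ = (map 𝓠 𝓢 k).toEquiv x ((map 𝓟 𝓠 m).toEquiv x ((α 𝓟).frame x p w))
        rw [hmap, hmap]
        rfl }
  have hfaithful : F.Faithful := ⟨fun {𝓟 𝓠} m m' hm => (α 𝓠).lift_unique fun x p w => by
    rw [← hmap, ← hmap]
    exact congrArg (fun ψ : F.obj 𝓟 ⟶ F.obj 𝓠 => ψ.toEquiv x ((α 𝓟).frame x p w)) hm⟩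
  have hfull : F.Full := ⟨fun {𝓟 𝓠} ψ => by
    obtain ⟨m, hm⟩ := (α 𝓟).exists_lift (α 𝓠) ψ
    exact ⟨m, (α 𝓟).map_unique fun x p w => (hmap 𝓟 𝓠 m x p w).trans (hm x p w).symm⟩⟩
  have hess : F.EssSurj := ⟨fun 𝓔 => by
    let 𝓟 : Opers.ThetaPositiveOper.{u, v} X triple := 𝓔.frameOper hS hS0 hf hh
    let β : Opers.Association 𝓟 𝓔 := 𝓔.association hS hS0 hf hh
    -- both `F 𝓟` and `𝓔` are associated to `𝓟`
    obtain ⟨a, ha⟩ := (α 𝓟).exists_map β (𝟙 𝓟)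
    obtain ⟨b, hb⟩ := β.exists_map (α 𝓟) (𝟙 𝓟)
    refine ⟨𝓟, ⟨⟨a, b, (α 𝓟).map_unique fun x p w => ?_, β.map_unique fun x p w => ?_⟩⟩⟩
    · change b.toEquiv x (a.toEquiv x _) = _
      rw [ha, hb]
      rfl
    · change a.toEquiv x (b.toEquiv x _) = _
      rw [hb, ha]
      rfl⟩
  have hequiv : F.IsEquivalence := { }
  exact ⟨F.asEquivalence, α, fun 𝓟 𝓠 m x p w => hmap 𝓟 𝓠 m x p w⟩
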